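/- Let $k$ be a field of characteristic zero. All vector spaces are $\mathbb Z/2$-graded over $k$, and operads are non-unital (partial compositions $\circ_i$ without an operadic unit), with components $\mathcal O(n)$, $n\ge 0$. Let $A_\infty$ be the non-symmetric dg operad freely generated by odd operations $m_n\in A_\infty(n)$, $n\ge 1$, with differential $$d(m_n)=\sum_{j=1}^{n}\sum_{i=1}^{j} m_j\circ_i m_{n-j+1},$$ and let $L_\infty$ be the symmetric dg operad freely generated by odd $S_n$-invariant operations $m_n\in L_\infty(n)$, $n\ge 1$, with differential $$d(m_n)=\sum_{j=1}^{n}\ \sum_{\sigma\in \mathrm{Sh}(n-j+1,\,j-1)}\sigma\,(m_j\circ_1 m_{n-j+1}),$$ where $\mathrm{Sh}(p,q)\subset S_{p+q}$ is the set of $(p,q)$-shuffles. For $\mathcal O=A_\infty$ or $L_\infty$ let $\mathcal O[x]$ be the operad obtained by freely adjoining an even operation $x$ of arity $0$, and let $\mathcal O[[x]]=\varprojlim_N \mathcal O[x]/(x)^N$ be its completion, where $(x)^N$ is spanned by the operadic monomials containing $x$ at least $N$ times. Let $\mathscr A_\infty=A_\infty[[x]]$ and $\mathscr L_\infty=L_\infty[[x]]$,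 with the continuous odd derivation $d$ that extends the differential of $A_\infty$, respectively $L_\infty$, and satisfies $$d(x)=\sum_{n\ge 1} m_n\circ(\underbrace{x\otimes\cdots\otimes x}_{n})\ \text{ in }\mathscr A_\infty,\qquad d(x)=\sum_{n\ge 1}\frac1{n!}\,m_n\circ(\underbrace{x\otimes\cdots\otimes x}_{n})\ \text{ in }\mathscr L_\infty .$$ (These operads govern $A_\infty$, respectively $L_\infty$, algebras together with a Maurer–Cartan element.) Then $\mathscr L_\infty$ and $\mathscr A_\infty$ are acyclic: in every arity $n\ge 0$ and every parity, $\ker d=\operatorname{im} d$; that is, $d^2=0$ and the homology of $\mathscr L_\infty(n)$ and $\mathscr A_\infty(n)$ vanishes. -/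

import Mathlib

/-!
Conventions. All vector spaces are `ℤ/2`-graded over a field `k`; the graded pieces are indexed by
`ZMod 2`. Operads are non-unital: arity `n` component `O(n)`, partial compositions
`∘_i : O(a) ⊗ O(b) → O(a + b - 1)`, and, in the symmetric case, left actions of `S_n`.
Inputs are numbered from `0`. To avoid natural number subtraction and casts the composition
carries its target arity `n` with a proof of `n + 1 = a + b` and its target parity `r` with a
proof of `r = p + q`.

The flag `s : Bool` distinguishes symmetric (`true`) from non-symmetric (`false`) operads.
-/

universe u

namespace MCOperad

/-- Formal operadic monomials in the generators `m n` (arity `n ≥ 1`, odd) and `x` (arity `0`, even),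
built with partial compositions and, if `s = true`, permutations of the inputs.
There is no constructor for an operadic unit. `Mono s n p` are those of arity `n` and parity `p`. -/
inductive Mono (s : Bool) : ℕ → ZMod 2 → Type
  | m (n : ℕ) (hn : 1 ≤ n) : Mono s n 1
  | x : Mono s 0 0
  | comp {a b n : ℕ} {p q r : ZMod 2} (i : ℕ) (hi : i < a) (hn : n + 1 = a + b)
      (hr : r = p + q) (f : Mono s a p) (g : Mono s b q) : Mono s n r
  | perm {n : ℕ} {p : ZMod 2} (hs : s = true) (σ : Equiv.Perm (Fin n)) (f : Mono s n p) :
      Mono s n p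

/-- The number of occurrences of `x` in a monomial. -/
def Mono.weight {s : Bool} : {n : ℕ} → {p : ZMod 2} → Mono s n p → ℕ
  | _, _, .m _ _ => 0
  | _, _, .x => 1
  | _, _, .comp _ _ _ _ f g => f.weight + g.weight
  | _, _, .perm _ _ f => f.weight

/-- The block permutation through which symmetric groups act on a composite:
`(σ f) ∘_{σ i} (τ g) = (blockPerm i σ τ) (f ∘_i g)`. The action is the left action for which, on
multilinear maps, `(σ f)(v_0, v_1, …) = f(v_{σ 0}, v_{σ 1}, …)`. This is its underlying function;
the inputs of `f ∘_i g` in the places `i, …, i + b - 1` are those of `g`. -/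
def blockFun {a b n : ℕ} (i : ℕ) (hi : i < a) (hn : n + 1 = a + b)
    (σ : Equiv.Perm (Fin a)) (τ : Equiv.Perm (Fin b)) (t : Fin n) : ℕ :=
  let c : ℕ := σ ⟨i, hi⟩
  let shift : Fin a → ℕ := fun u => if (u : ℕ) < c then u else u + b - 1
  if h₁ : (t : ℕ) < i then shift (σ ⟨t, by omega⟩)
  else if h₂ : (t : ℕ) < i + b then c + τ ⟨t - i, by omega⟩
  else shift (σ ⟨t + 1 - b, by omega⟩)

theorem perm_val_ne {a : ℕ} (σ : Equiv.Perm (Fin a)) {u v : ℕ} (hu : u < a) (hv : v < a)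
    (h : u ≠ v) : (σ ⟨u, hu⟩ : ℕ) ≠ σ ⟨v, hv⟩ := by
  intro e
  exact h (congrArg Fin.val (σ.injective (Fin.ext e)))

theorem blockFun_lt {a b n : ℕ} (i : ℕ) (hi : i < a) (hn : n + 1 = a + b)
    (σ : Equiv.Perm (Fin a)) (τ : Equiv.Perm (Fin b)) (t : Fin n) :
    blockFun i hi hn σ τ t < n := by
  have hc := (σ ⟨i, hi⟩).isLt
  simp only [blockFun]
  split_ifs with h₁ h₂ h₃ h₄
  · omega
  · have := (σ ⟨t, by omega⟩).isLt
    have := perm_val_ne σ (u := t) (v := i) (by omega) hi (by omega)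
    omega
  · have := (τ ⟨t - i, by omega⟩).isLt
    omega
  · omega
  · have := (σ ⟨t + 1 - b, by omega⟩).isLt
    have := perm_val_ne σ (u := t + 1 - b) (v := i) (by omega) hi (by omega)
    omega

theorem blockFun_injective {a b n : ℕ} (i : ℕ) (hi : i < a) (hn : n + 1 = a + b)
    (σ : Equiv.Perm (Fin a)) (τ : Equiv.Perm (Fin b)) {t t' : Fin n}
    (h : blockFun i hi hn σ τ t = blockFun i hi hn σ τ t') : t = t' := by
  by_contra hne
  have hne : (t : ℕ) ≠ t' := fun e => hne (Fin.ext e)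
  have hc := (σ ⟨i, hi⟩).isLt
  have key : ∀ (t : Fin n), ((t : ℕ) < i ∧ ∃ u, ∃ hu : u < a, u = t ∧ u ≠ i ∧
        blockFun i hi hn σ τ t = if (σ ⟨u, hu⟩ : ℕ) < σ ⟨i, hi⟩ then (σ ⟨u, hu⟩ : ℕ)
          else σ ⟨u, hu⟩ + b - 1) ∨
      (i ≤ (t : ℕ) ∧ (t : ℕ) < i + b ∧ ∃ hu : t - i < b,
        blockFun i hi hn σ τ t = σ ⟨i, hi⟩ + τ ⟨t - i, hu⟩) ∨
      (i + b ≤ (t : ℕ) ∧ ∃ u, ∃ hu : u < a, u = t + 1 - b ∧ u ≠ i ∧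
        blockFun i hi hn σ τ t = if (σ ⟨u, hu⟩ : ℕ) < σ ⟨i, hi⟩ then (σ ⟨u, hu⟩ : ℕ)
          else σ ⟨u, hu⟩ + b - 1) := by
    intro t
    by_cases h₁ : (t : ℕ) < i
    · left
      exact ⟨h₁, t, by omega, rfl, by omega, by simp [blockFun, h₁]⟩
    · by_cases h₂ : (t : ℕ) < i + b
      · right; left
        exact ⟨by omega, h₂, by omega, by simp [blockFun, h₁, h₂]⟩
      · right; right
        exact ⟨by omega, t + 1 - b, by omega, rfl, by omega, by simp [blockFun, h₁, h₂]⟩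
  have two : ∀ u u' (hu : u < a) (hu' : u' < a), u ≠ u' → u ≠ i → u' ≠ i →
      (if (σ ⟨u, hu⟩ : ℕ) < σ ⟨i, hi⟩ then (σ ⟨u, hu⟩ : ℕ) else σ ⟨u, hu⟩ + b - 1) ≠
      (if (σ ⟨u', hu'⟩ : ℕ) < σ ⟨i, hi⟩ then (σ ⟨u', hu'⟩ : ℕ) else σ ⟨u', hu'⟩ + b - 1) := by
    intro u u' hu hu' h h1 h2
    have := perm_val_ne σ hu hu' h
    have := perm_val_ne σ hu hi h1
    have := perm_val_ne σ hu' hi h2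
    split_ifs <;> omega
  have one : ∀ u (hu : u < a) v (hv : v < b), u ≠ i →
      (if (σ ⟨u, hu⟩ : ℕ) < σ ⟨i, hi⟩ then (σ ⟨u, hu⟩ : ℕ) else σ ⟨u, hu⟩ + b - 1) ≠
      (σ ⟨i, hi⟩ + τ ⟨v, hv⟩ : ℕ) := by
    intro u hu v hv h1
    have := perm_val_ne σ hu hi h1
    have := (τ ⟨v, hv⟩).isLt
    split_ifs <;> omega
  rcases key t with ⟨ht, u, hu, hu1, hu2, e⟩ | ⟨ht, ht2, hu, e⟩ | ⟨ht, u, hu, hu1, hu2, e⟩ <;>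
  rcases key t' with ⟨ht', u', hu', hu1', hu2', e'⟩ | ⟨ht', ht2', hu', e'⟩ |
    ⟨ht', u', hu', hu1', hu2', e'⟩ <;> rw [e, e'] at h
  · exact two u u' hu hu' (by omega) hu2 hu2' h
  · exact one u hu _ hu' hu2 h
  · exact two u u' hu hu' (by omega) hu2 hu2' h
  · exact one u' hu' _ hu hu2' h.symm
  · have := perm_val_ne τ hu hu' (by omega)
    omega
  · exact one u' hu' _ hu hu2' h.symm
  · exact two u u' hu hu' (by omega) hu2 hu2' h
  · exact one u hu _ hu' hu2 h
  · exact two u u' hu hu' (by omega) hu2 hu2' h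

/-- The block permutation of a composite, as a permutation. -/
noncomputable def blockPerm {a b n : ℕ} (i : ℕ) (hi : i < a) (hn : n + 1 = a + b)
    (σ : Equiv.Perm (Fin a)) (τ : Equiv.Perm (Fin b)) : Equiv.Perm (Fin n) :=
  Equiv.ofBijective (fun t => ⟨blockFun i hi hn σ τ t, blockFun_lt i hi hn σ τ t⟩)
    (Finite.injective_iff_bijective.mp fun _ _ h =>
      blockFun_injective i hi hn σ τ (congrArg Fin.val h))

/-- `Rel e f g` is the relation `f = (-1)^e g` between monomials: the axioms of a (`ℤ/2`-graded,
non-unital) operad, the invariance of `m n` under `S_n` in the symmetric case, and the closure of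
these under compositions and permutations. -/
inductive Rel {s : Bool} : {n : ℕ} → {p : ZMod 2} → ZMod 2 → Mono s n p → Mono s n p → Prop
  /-- Sequential associativity. -/
  | seq {a b c n₁ n₂ n : ℕ} {p q r p₁ p₂ p₃ : ZMod 2} {i j : ℕ} (hi : i < a) (hj : j < b)
      (h₁ : n₁ + 1 = a + b) (h₂ : n + 1 = n₁ + c) (h₃ : n₂ + 1 = b + c) (h₄ : n + 1 = a + n₂)
      (hij : i + j < n₁)
      (e₁ : p₁ = p + q) (e₂ : p₃ = p₁ + r) (e₃ : p₂ = q + r) (e₄ : p₃ = p + p₂)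
      (f : Mono s a p) (g : Mono s b q) (h : Mono s c r) :
      Rel 0 (.comp (i + j) hij h₂ e₂ (.comp i hi h₁ e₁ f g) h)
        (.comp i hi h₄ e₄ f (.comp j hj h₃ e₃ g h))
  /-- Parallel associativity, with its Koszul sign. -/
  | par {a b c n₁ n₂ n : ℕ} {p q r p₁ p₂ p₃ : ZMod 2} {i j l : ℕ} (hi : i < a) (hj : j < a)
      (hij : i < j) (hl : l + 1 = j + b)
      (h₁ : n₁ + 1 = a + b) (h₂ : n + 1 = n₁ + c) (h₃ : n₂ + 1 = a + c) (h₄ : n + 1 = n₂ + b)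
      (hl' : l < n₁) (hi' : i < n₂)
      (e₁ : p₁ = p + q) (e₂ : p₃ = p₁ + r) (e₃ : p₂ = p + r) (e₄ : p₃ = p₂ + q)
      (f : Mono s a p) (g : Mono s b q) (h : Mono s c r) :
      Rel (q * r) (.comp l hl' h₂ e₂ (.comp i hi h₁ e₁ f g) h)
        (.comp i hi' h₄ e₄ (.comp j hj h₃ e₃ f h) g)
  /-- The symmetric groups act. -/
  | perm_one {n : ℕ} {p : ZMod 2} (hs : s = true) (f : Mono s n p) : Rel 0 (.perm hs 1 f) f
  | perm_mul {n : ℕ} {p : ZMod 2} (hs : s = true) (σ τ : Equiv.Perm (Fin n)) (f : Mono s n p) :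
      Rel 0 (.perm hs (σ * τ) f) (.perm hs σ (.perm hs τ f))
  /-- Equivariance of the compositions. -/
  | perm_comp {a b n : ℕ} {p q r : ZMod 2} (hs : s = true) (i : ℕ) (hi : i < a)
      (hn : n + 1 = a + b) (hr : r = p + q) (σ : Equiv.Perm (Fin a)) (τ : Equiv.Perm (Fin b))
      (f : Mono s a p) (g : Mono s b q) :
      Rel 0 (.comp (σ ⟨i, hi⟩) (σ ⟨i, hi⟩).isLt hn hr (.perm hs σ f) (.perm hs τ g))
        (.perm hs (blockPerm i hi hn σ τ) (.comp i hi hn hr f g))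
  /-- The symmetric groups act trivially on the generators. -/
  | perm_m (hs : s = true) (n : ℕ) (hn : 1 ≤ n) (σ : Equiv.Perm (Fin n)) :
      Rel 0 (.perm hs σ (.m n hn)) (.m n hn)
  | comp_left {a b n : ℕ} {p q r : ZMod 2} {e : ZMod 2} (i : ℕ) (hi : i < a)
      (hn : n + 1 = a + b) (hr : r = p + q) {f f' : Mono s a p} (g : Mono s b q)
      (h : Rel e f f') : Rel e (.comp i hi hn hr f g) (.comp i hi hn hr f' g)
  | comp_right {a b n : ℕ} {p q r : ZMod 2} {e : ZMod 2} (i : ℕ) (hi : i < a)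
      (hn : n + 1 = a + b) (hr : r = p + q) (f : Mono s a p) {g g' : Mono s b q}
      (h : Rel e g g') : Rel e (.comp i hi hn hr f g) (.comp i hi hn hr f g')
  | perm_congr {n : ℕ} {p : ZMod 2} {e : ZMod 2} (hs : s = true) (σ : Equiv.Perm (Fin n))
      {f f' : Mono s n p} (h : Rel e f f') : Rel e (.perm hs σ f) (.perm hs σ f')

/-- The sign `(-1)^e`. -/
def sgn (k : Type*) [Ring k] (e : ZMod 2) : k := if e = 0 then 1 else -1

/-- The subspace spanned by the operadic relations. -/
noncomputable def relSub (k : Type*) [Field k] (s : Bool) (n : ℕ) (p : ZMod 2) :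
    Submodule k (Mono s n p →₀ k) :=
  Submodule.span k {z | ∃ e f f', Rel e f f' ∧
    z = Finsupp.single f 1 - sgn k e • Finsupp.single f' 1}

/-- The component of arity `n` and parity `p` of the free graded operad (symmetric if `s = true`,
non-symmetric if `s = false`) on the generators `m n`, `n ≥ 1` (odd, of arity `n`, and
`S_n`-invariant in the symmetric case) and `x` (even, of arity `0`). As `A_∞` (`s = false`) and
`L_∞` (`s = true`) are the free operads on the `m n`, this is the operad `A_∞[x]`, respectively
`L_∞[x]`, obtained from them by freely adjoining `x`. -/
def FreeOp (k : Type u) [Field k] (s : Bool) (n : ℕ) (p : ZMod 2) : Type u :=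
  (Mono s n p →₀ k) ⧸ relSub k s n p

noncomputable instance (k : Type u) [Field k] (s : Bool) (n : ℕ) (p : ZMod 2) :
    AddCommGroup (FreeOp k s n p) :=
  inferInstanceAs (AddCommGroup ((Mono s n p →₀ k) ⧸ relSub k s n p))

noncomputable instance (k : Type u) [Field k] (s : Bool) (n : ℕ) (p : ZMod 2) :
    Module k (FreeOp k s n p) :=
  inferInstanceAs (Module k ((Mono s n p →₀ k) ⧸ relSub k s n p))

variable {k : Type u} [Field k] {s : Bool}

variable (k) in
/-- The quotient map from formal linear combinations of monomials. -/
noncomputable def proj {n : ℕ} {p : ZMod 2} : (Mono s n p →₀ k) →ₗ[k] FreeOp k s n p :=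
  (relSub k s n p).mkQ

variable (k) in
/-- The class of a monomial. -/
noncomputable def of {n : ℕ} {p : ZMod 2} (f : Mono s n p) : FreeOp k s n p :=
  proj k (Finsupp.single f 1)

theorem of_rel {n : ℕ} {p e : ZMod 2} {f f' : Mono s n p} (h : Rel e f f') :
    of k f = sgn k e • of k f' := by
  rw [← sub_eq_zero, of, of, ← map_smul, ← map_sub]
  exact (Submodule.Quotient.mk_eq_zero _).mpr (Submodule.subset_span ⟨e, f, f', h, rfl⟩)

/-- A linear map out of `FreeOp` from a function on monomials respecting the relations. -/
noncomputable def liftOp {M : Type*} [AddCommGroup M] [Module k M] {n : ℕ} {p : ZMod 2}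
    (φ : Mono s n p → M) (hφ : ∀ e f f', Rel e f f' → φ f = sgn k e • φ f') :
    FreeOp k s n p →ₗ[k] M :=
  (relSub k s n p).liftQ (Finsupp.linearCombination k φ) (by
    rw [relSub, Submodule.span_le]
    rintro _ ⟨e, f, f', h, rfl⟩
    simp [hφ e f f' h])

@[simp] theorem liftOp_of {M : Type*} [AddCommGroup M] [Module k M] {n : ℕ} {p : ZMod 2}
    (φ : Mono s n p → M) (hφ : ∀ e f f', Rel e f f' → φ f = sgn k e • φ f') (f : Mono s n p) :
    liftOp φ hφ (of k f) = φ f :=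
  (Submodule.liftQ_apply _ _ _).trans (by simp)

@[elab_as_elim]
theorem induction_on {n : ℕ} {p : ZMod 2} {P : FreeOp k s n p → Prop} (z : FreeOp k s n p)
    (of : ∀ f, P (of k f)) (zero : P 0) (add : ∀ x y, P x → P y → P (x + y))
    (smul : ∀ (c : k) x, P x → P (c • x)) : P z := by
  obtain ⟨w, rfl⟩ : ∃ w, proj k w = z := Submodule.mkQ_surjective _ z
  induction w using Finsupp.induction_linear with
  | zero => rw [map_zero]; exact zero
  | add f g hf hg => rw [map_add]; exact add _ _ hf hg
  | single f c =>
    have := smul c _ (of f)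
    rwa [MCOperad.of, ← map_smul, Finsupp.smul_single, smul_eq_mul, mul_one] at this

theorem hom_ext {M : Type*} [AddCommGroup M] [Module k M] {n : ℕ} {p : ZMod 2}
    {φ ψ : FreeOp k s n p →ₗ[k] M} (h : ∀ f, φ (of k f) = ψ (of k f)) : φ = ψ := by
  ext z
  induction z using induction_on with
  | of f => exact h f
  | zero => simp
  | add x y hx hy => simp [hx, hy]
  | smul c x hx => simp [hx]

/-- Partial composition `f ∘_i g` of the free operad. -/
noncomputable def comp {a b n : ℕ} {p q r : ZMod 2} (i : ℕ) (hi : i < a)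
    (hn : n + 1 = a + b) (hr : r = p + q) :
    FreeOp k s a p →ₗ[k] FreeOp k s b q →ₗ[k] FreeOp k s n r :=
  liftOp (fun f => liftOp (fun g => of k (.comp i hi hn hr f g))
      fun _ _ _ h => of_rel (.comp_right i hi hn hr f h))
    fun e f f' h => hom_ext fun g => by
      simpa using of_rel (.comp_left i hi hn hr g h)

@[simp] theorem comp_of {a b n : ℕ} {p q r : ZMod 2} (i : ℕ) (hi : i < a)
    (hn : n + 1 = a + b) (hr : r = p + q) (f : Mono s a p) (g : Mono s b q) :
    comp i hi hn hr (of k f) (of k g) = of k (.comp i hi hn hr f g) := by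
  simp [comp]

/-- Action of the symmetric group on the free symmetric operad. -/
noncomputable def perm {n : ℕ} {p : ZMod 2} (hs : s = true) (σ : Equiv.Perm (Fin n)) :
    FreeOp k s n p →ₗ[k] FreeOp k s n p :=
  liftOp (fun f => of k (.perm hs σ f)) fun _ _ _ h => of_rel (.perm_congr hs σ h)

@[simp] theorem perm_of {n : ℕ} {p : ZMod 2} (hs : s = true) (σ : Equiv.Perm (Fin n))
    (f : Mono s n p) : perm hs σ (of k f) = of k (.perm hs σ f) := by
  simp [perm]

theorem sgn_zero : sgn k 0 = 1 := by simp [sgn]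

theorem comp_seq {a b c n₁ n₂ n : ℕ} {p q r p₁ p₂ p₃ : ZMod 2} {i j : ℕ} (hi : i < a)
    (hj : j < b) (h₁ : n₁ + 1 = a + b) (h₂ : n + 1 = n₁ + c) (h₃ : n₂ + 1 = b + c)
    (h₄ : n + 1 = a + n₂) (hij : i + j < n₁)
    (e₁ : p₁ = p + q) (e₂ : p₃ = p₁ + r) (e₃ : p₂ = q + r) (e₄ : p₃ = p + p₂)
    (f : FreeOp k s a p) (g : FreeOp k s b q) (h : FreeOp k s c r) :
    comp (i + j) hij h₂ e₂ (comp i hi h₁ e₁ f g) h =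
      comp i hi h₄ e₄ f (comp j hj h₃ e₃ g h) := by
  induction f using induction_on with
  | zero => simp
  | add x y hx hy => simp only [map_add, LinearMap.add_apply, hx, hy]
  | smul c x hx => simp only [map_smul, LinearMap.smul_apply, hx]
  | of f =>
  induction g using induction_on with
  | zero => simp
  | add x y hx hy => simp only [map_add, LinearMap.add_apply, hx, hy]
  | smul c x hx => simp only [map_smul, LinearMap.smul_apply, hx]
  | of g =>
  induction h using induction_on with
  | zero => simp
  | add x y hx hy => simp only [map_add, hx, hy]
  | smul c x hx => simp only [map_smul, hx]
  | of h =>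
    simpa [sgn_zero] using of_rel (k := k) (.seq hi hj h₁ h₂ h₃ h₄ hij e₁ e₂ e₃ e₄ f g h)

theorem comp_par {a b c n₁ n₂ n : ℕ} {p q r p₁ p₂ p₃ : ZMod 2} {i j l : ℕ} (hi : i < a)
    (hj : j < a) (hij : i < j) (hl : l + 1 = j + b)
    (h₁ : n₁ + 1 = a + b) (h₂ : n + 1 = n₁ + c) (h₃ : n₂ + 1 = a + c) (h₄ : n + 1 = n₂ + b)
    (hl' : l < n₁) (hi' : i < n₂)
    (e₁ : p₁ = p + q) (e₂ : p₃ = p₁ + r) (e₃ : p₂ = p + r) (e₄ : p₃ = p₂ + q)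
    (f : FreeOp k s a p) (g : FreeOp k s b q) (h : FreeOp k s c r) :
    comp l hl' h₂ e₂ (comp i hi h₁ e₁ f g) h =
      sgn k (q * r) • comp i hi' h₄ e₄ (comp j hj h₃ e₃ f h) g := by
  induction f using induction_on with
  | zero => simp
  | add x y hx hy => simp only [map_add, LinearMap.add_apply, hx, hy, smul_add]
  | smul c x hx => simp only [map_smul, LinearMap.smul_apply, hx, smul_comm c]
  | of f =>
  induction g using induction_on with
  | zero => simp
  | add x y hx hy => simp only [map_add, LinearMap.add_apply, hx, hy, smul_add]
  | smul c x hx => simp only [map_smul, LinearMap.smul_apply, hx, smul_comm c]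
  | of g =>
  induction h using induction_on with
  | zero => simp
  | add x y hx hy => simp only [map_add, LinearMap.add_apply, hx, hy, smul_add]
  | smul c x hx => simp only [map_smul, LinearMap.smul_apply, hx, smul_comm c]
  | of h =>
    simpa using of_rel (k := k) (.par hi hj hij hl h₁ h₂ h₃ h₄ hl' hi' e₁ e₂ e₃ e₄ f g h)

theorem perm_one_apply {n : ℕ} {p : ZMod 2} (hs : s = true) (f : FreeOp k s n p) :
    perm hs 1 f = f := by
  induction f using induction_on with
  | zero => simp
  | add x y hx hy => simp only [map_add, hx, hy]
  | smul c x hx => simp only [map_smul, hx]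
  | of f => simpa [sgn_zero] using of_rel (k := k) (.perm_one hs f)

theorem perm_mul_apply {n : ℕ} {p : ZMod 2} (hs : s = true) (σ τ : Equiv.Perm (Fin n))
    (f : FreeOp k s n p) : perm hs (σ * τ) f = perm hs σ (perm hs τ f) := by
  induction f using induction_on with
  | zero => simp
  | add x y hx hy => simp only [map_add, hx, hy]
  | smul c x hx => simp only [map_smul, hx]
  | of f => simpa [sgn_zero] using of_rel (k := k) (.perm_mul hs σ τ f)

theorem comp_perm {a b n : ℕ} {p q r : ZMod 2} (hs : s = true) (i : ℕ) (hi : i < a)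
    (hn : n + 1 = a + b) (hr : r = p + q) (σ : Equiv.Perm (Fin a)) (τ : Equiv.Perm (Fin b))
    (f : FreeOp k s a p) (g : FreeOp k s b q) :
    comp (σ ⟨i, hi⟩) (σ ⟨i, hi⟩).isLt hn hr (perm hs σ f) (perm hs τ g) =
      perm hs (blockPerm i hi hn σ τ) (comp i hi hn hr f g) := by
  induction f using induction_on with
  | zero => simp
  | add x y hx hy => simp only [map_add, LinearMap.add_apply, hx, hy]
  | smul c x hx => simp only [map_smul, LinearMap.smul_apply, hx]
  | of f =>
  induction g using induction_on with
  | zero => simp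
  | add x y hx hy => simp only [map_add, hx, hy]
  | smul c x hx => simp only [map_smul, hx]
  | of g => simpa [sgn_zero] using of_rel (k := k) (.perm_comp hs i hi hn hr σ τ f g)

/-- The derivation with prescribed values on the generators, evaluated on monomials:
`d (f ∘_i g) = d f ∘_i g + (-1)^|f| f ∘_i d g` and `d (σ f) = σ (d f)`. -/
noncomputable def derMono (δm : ∀ n, 1 ≤ n → FreeOp k s n (1 + 1)) (δx : FreeOp k s 0 (0 + 1)) :
    {n : ℕ} → {p : ZMod 2} → Mono s n p → FreeOp k s n (p + 1)
  | _, _, .m n hn => δm n hn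
  | _, _, .x => δx
  | _, _, .comp (p := p) (q := q) i hi hn hr f g =>
      comp i hi hn (by rw [hr]; ring) (derMono δm δx f) (of k g) +
        sgn k p • comp i hi hn (by rw [hr]; ring) (of k f) (derMono δm δx g)
  | _, _, .perm hs σ f => perm hs σ (derMono δm δx f)

theorem zmod2_cases (p : ZMod 2) : p = 0 ∨ p = 1 := by
  revert p; decide

theorem sgn_one : sgn k 1 = -1 := by simp [sgn]

theorem sgn_add (p q : ZMod 2) : sgn k (p + q) = sgn k p * sgn k q := by
  rcases zmod2_cases p with rfl | rfl <;> rcases zmod2_cases q with rfl | rfl <;>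
    simp [sgn_zero, sgn_one, show (1 + 1 : ZMod 2) = 0 from rfl]

theorem derMono_rel (δm : ∀ n, 1 ≤ n → FreeOp k s n (1 + 1)) (δx : FreeOp k s 0 (0 + 1))
    (hδ : ∀ hs n hn σ, perm hs σ (δm n hn) = δm n hn) {n : ℕ} {p e : ZMod 2} {f f' : Mono s n p}
    (h : Rel e f f') : derMono δm δx f = sgn k e • derMono δm δx f' := by
  induction h with
  | @seq a b c n₁ n₂ n p q r p₁ p₂ p₃ i j hi hj h₁ h₂ h₃ h₄ hij e₁ e₂ e₃ e₄ f g h =>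
    subst e₁ e₃
    simp only [derMono, map_add, LinearMap.add_apply, map_smul, LinearMap.smul_apply,
      ← comp_of, sgn_zero, one_smul, smul_add, smul_smul, ← sgn_add]
    rw [comp_seq (p₂ := q + r) hi hj h₁ h₂ h₃ h₄ hij _ _ _ _ (derMono δm δx f),
      comp_seq (p₂ := q + r + 1) hi hj h₁ h₂ h₃ h₄ hij _ _ _ _ (of k f) (derMono δm δx g),
      comp_seq (p₂ := q + r + 1) hi hj h₁ h₂ h₃ h₄ hij _ _ _ _ (of k f) (of k g) (derMono δm δx h), add_assoc]
    all_goals (subst_vars; ring_nf)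
  | @par a b c n₁ n₂ n p q r p₁ p₂ p₃ i j l hi hj hij hl h₁ h₂ h₃ h₄ hl' hi' e₁ e₂ e₃ e₄ f g h =>
    subst e₁ e₃
    simp only [derMono, map_add, LinearMap.add_apply, map_smul, LinearMap.smul_apply,
      ← comp_of, smul_add, smul_smul]
    rw [comp_par hi hj hij hl h₁ h₂ h₃ h₄ hl' hi' _ _ _ _ (derMono δm δx f),
      comp_par hi hj hij hl h₁ h₂ h₃ h₄ hl' hi' _ _ _ _ (of k f) (derMono δm δx g),
      comp_par hi hj hij hl h₁ h₂ h₃ h₄ hl' hi' _ _ _ _ (of k f) (of k g) (derMono δm δx h)]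
    · simp only [smul_smul, ← sgn_add]
      rw [show p + (q + 1) * r = q * r + (p + r) by ring,
        show p + q + q * (r + 1) = q * r + p + (q + q) by ring,
        show q + q = 0 from CharTwo.add_self_eq_zero q, add_zero]
      abel_nf
    all_goals (subst_vars; ring_nf)
  | perm_one hs f => simp [derMono, perm_one_apply, sgn_zero]
  | perm_mul hs σ τ f => simp [derMono, perm_mul_apply, sgn_zero]
  | perm_comp hs i hi hn hr σ τ f g =>
    simp only [derMono, ← perm_of, sgn_zero, one_smul, map_add, map_smul, comp_perm]
  | perm_m hs n hn σ => simp [derMono, hδ, sgn_zero]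
  | comp_left i hi hn hr g h ih =>
    simp only [derMono, ih, of_rel h, map_smul, LinearMap.smul_apply, smul_add, smul_smul,
      mul_comm]
  | comp_right i hi hn hr f h ih =>
    simp only [derMono, ih, of_rel h, map_smul, smul_add, smul_smul, mul_comm]
  | perm_congr hs σ h ih => simp only [derMono, ih, map_smul]

/-- The odd derivation of the free operad with prescribed values on the generators. -/
noncomputable def der (δm : ∀ n, 1 ≤ n → FreeOp k s n (1 + 1)) (δx : FreeOp k s 0 (0 + 1))
    (hδ : ∀ hs n hn σ, perm hs σ (δm n hn) = δm n hn) (n : ℕ) (p : ZMod 2) :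
    FreeOp k s n p →ₗ[k] FreeOp k s n (p + 1) :=
  liftOp (derMono δm δx) fun _ _ _ h => derMono_rel δm δx hδ h

@[simp] theorem der_of (δm : ∀ n, 1 ≤ n → FreeOp k s n (1 + 1)) (δx : FreeOp k s 0 (0 + 1))
    (hδ : ∀ hs n hn σ, perm hs σ (δm n hn) = δm n hn) {n : ℕ} {p : ZMod 2} (f : Mono s n p) :
    der δm δx hδ n p (of k f) = derMono δm δx f := by
  simp [der]

variable (k s) in
/-- The power `(x)^N` of the operadic ideal generated by `x`, in arity `n` and parity `p`: the span
of all operadic monomials containing `x` at least `N` times. -/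
noncomputable def xIdeal (N n : ℕ) (p : ZMod 2) : Submodule k (FreeOp k s n p) :=
  Submodule.span k {z | ∃ f : Mono s n p, N ≤ f.weight ∧ z = of k f}

theorem of_mem_xIdeal {N n : ℕ} {p : ZMod 2} (f : Mono s n p) (h : N ≤ f.weight) :
    of k f ∈ xIdeal k s N n p :=
  Submodule.subset_span ⟨f, h, rfl⟩

theorem xIdeal_anti {M N : ℕ} (h : M ≤ N) (n : ℕ) (p : ZMod 2) :
    xIdeal k s N n p ≤ xIdeal k s M n p :=
  Submodule.span_mono fun _ ⟨f, hf, e⟩ => ⟨f, h.trans hf, e⟩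

theorem mem_xIdeal_zero {n : ℕ} {p : ZMod 2} (z : FreeOp k s n p) : z ∈ xIdeal k s 0 n p := by
  induction z using induction_on with
  | of f => exact of_mem_xIdeal f (Nat.zero_le _)
  | zero => exact zero_mem _
  | add x y hx hy => exact add_mem hx hy
  | smul c x hx => exact Submodule.smul_mem _ c hx

theorem comp_mem_xIdeal {a b n M N : ℕ} {p q r : ZMod 2} {i : ℕ} (hi : i < a)
    (hn : n + 1 = a + b) (hr : r = p + q) {f : FreeOp k s a p} {g : FreeOp k s b q}
    (hf : f ∈ xIdeal k s M a p) (hg : g ∈ xIdeal k s N b q) :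
    comp i hi hn hr f g ∈ xIdeal k s (M + N) n r := by
  induction hf using Submodule.span_induction with
  | zero => simp
  | add x y _ _ hx hy => rw [map_add]; exact add_mem hx hy
  | smul c x _ hx => rw [map_smul]; exact Submodule.smul_mem _ c hx
  | mem f hf =>
  obtain ⟨f, hf, rfl⟩ := hf
  induction hg using Submodule.span_induction with
  | zero => simp
  | add x y _ _ hx hy => rw [map_add]; exact add_mem hx hy
  | smul c x _ hx => rw [map_smul]; exact Submodule.smul_mem _ c hx
  | mem g hg =>
  obtain ⟨g, hg, rfl⟩ := hg
  rw [comp_of]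
  exact of_mem_xIdeal _ (Nat.add_le_add hf hg)

theorem perm_mem_xIdeal {n N : ℕ} {p : ZMod 2} (hs : s = true) (σ : Equiv.Perm (Fin n))
    {f : FreeOp k s n p} (hf : f ∈ xIdeal k s N n p) : perm hs σ f ∈ xIdeal k s N n p := by
  induction hf using Submodule.span_induction with
  | zero => simp
  | add x y _ _ hx hy => rw [map_add]; exact add_mem hx hy
  | smul c x _ hx => rw [map_smul]; exact Submodule.smul_mem _ c hx
  | mem f hf =>
  obtain ⟨f, hf, rfl⟩ := hf
  rw [perm_of]
  exact of_mem_xIdeal _ hf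

theorem derMono_mem (δm : ∀ n, 1 ≤ n → FreeOp k s n (1 + 1)) (δx : FreeOp k s 0 (0 + 1))
    (hx : δx ∈ xIdeal k s 1 0 (0 + 1)) {n : ℕ} {p : ZMod 2} (f : Mono s n p) :
    derMono δm δx f ∈ xIdeal k s f.weight n (p + 1) := by
  induction f with
  | m n hn => exact mem_xIdeal_zero _
  | x => exact hx
  | comp i hi hn hr f g hf hg =>
    exact add_mem (comp_mem_xIdeal _ _ _ hf (of_mem_xIdeal g le_rfl))
      (Submodule.smul_mem _ _ (comp_mem_xIdeal _ _ _ (of_mem_xIdeal f le_rfl) hg))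
  | perm hs σ f hf => exact perm_mem_xIdeal _ _ hf

theorem derMono_sub_mem (δm : ∀ n, 1 ≤ n → FreeOp k s n (1 + 1)) {δx δx' : FreeOp k s 0 (0 + 1)}
    {M : ℕ} (hx : δx - δx' ∈ xIdeal k s M 0 (0 + 1)) {n : ℕ} {p : ZMod 2} (f : Mono s n p) :
    derMono δm δx f - derMono δm δx' f ∈ xIdeal k s M n (p + 1) := by
  induction f with
  | m n hn => simp [derMono]
  | x => exact hx
  | comp i hi hn hr f g hf hg =>
    subst hr
    have h₁ := comp_mem_xIdeal (k := k) hi hn (add_right_comm _ _ _) hf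
      (mem_xIdeal_zero (of k g))
    have h₂ := comp_mem_xIdeal (k := k) hi hn (add_assoc _ _ _)
      (mem_xIdeal_zero (of k f)) hg
    rw [zero_add] at h₂
    simp only [derMono, add_sub_add_comm, ← smul_sub, ← map_sub, ← LinearMap.sub_apply]
    exact add_mem h₁ (Submodule.smul_mem _ _ h₂)
  | perm hs σ f hf =>
    simp only [derMono, ← map_sub]
    exact perm_mem_xIdeal _ _ hf

/-- `f ∘ (x ⊗ … ⊗ x)` for `f` of arity `j`: the operation `x` is inserted into all inputs, from the
last one to the first. -/
noncomputable def plugX : (j : ℕ) → {p : ZMod 2} → FreeOp k s j p → FreeOp k s 0 p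
  | 0, _, f => f
  | j + 1, p, f => plugX j (comp (n := j) (b := 0) j (Nat.lt_succ_self j) rfl (add_zero p).symm f (of k .x))

theorem plugX_mem {N : ℕ} (j : ℕ) {p : ZMod 2} (f : FreeOp k s j p)
    (hf : f ∈ xIdeal k s N j p) : plugX j f ∈ xIdeal k s (N + j) 0 p := by
  induction j generalizing N with
  | zero => exact hf
  | succ j ih =>
    rw [plugX, show N + (j + 1) = (N + 1) + j by ring]
    exact ih _ (comp_mem_xIdeal _ _ _ hf (of_mem_xIdeal .x le_rfl))

/-- The partial sum `∑_{n=1}^N c_n • m_n ∘ (x ⊗ … ⊗ x)`. -/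
noncomputable def mcSum (c : ℕ → k) (N : ℕ) : FreeOp k s 0 (0 + 1) :=
  ∑ j ∈ Finset.range N, c (j + 1) • plugX (j + 1) (of k (.m (j + 1) (Nat.le_add_left 1 j)))

theorem mcSum_mem (c : ℕ → k) (N : ℕ) : mcSum c N ∈ xIdeal k s 1 0 (0 + 1) :=
  Submodule.sum_mem _ fun j _ => Submodule.smul_mem _ _
    (xIdeal_anti (by omega) _ _ (plugX_mem (N := 0) _ _ (mem_xIdeal_zero _)))

theorem mcSum_sub_mem (c : ℕ → k) {M N : ℕ} (h : M ≤ N) :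
    mcSum c N - mcSum c M ∈ xIdeal k s M 0 (0 + 1) := by
  rw [mcSum, mcSum, ← Finset.sum_Ico_eq_sub _ h]
  refine Submodule.sum_mem _ fun j hj => Submodule.smul_mem _ _
    (xIdeal_anti ?_ _ _ (plugX_mem (N := 0) _ _ (mem_xIdeal_zero _)))
  have := (Finset.mem_Ico.mp hj).1
  omega

theorem der_mem (δm : ∀ n, 1 ≤ n → FreeOp k s n (1 + 1))
    (hδ : ∀ hs n hn σ, perm hs σ (δm n hn) = δm n hn) (c : ℕ → k) (N n : ℕ) (p : ZMod 2) :
    xIdeal k s N n p ≤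
      (xIdeal k s N n (p + 1)).comap (der δm (mcSum c N) hδ n p) := by
  rw [xIdeal, Submodule.span_le]
  rintro _ ⟨f, hf, rfl⟩
  simpa using xIdeal_anti hf _ _ (derMono_mem δm _ (mcSum_mem c N) f)

theorem der_sub_mem (δm : ∀ n, 1 ≤ n → FreeOp k s n (1 + 1))
    (hδ : ∀ hs n hn σ, perm hs σ (δm n hn) = δm n hn) (c : ℕ → k) {M N : ℕ} (h : M ≤ N)
    {n : ℕ} {p : ZMod 2} (z : FreeOp k s n p) :
    der δm (mcSum c N) hδ n p z - der δm (mcSum c M) hδ n p z ∈ xIdeal k s M n (p + 1) := by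
  induction z using induction_on with
  | of f => simpa using derMono_sub_mem δm (mcSum_sub_mem c h) f
  | zero => simp
  | add x y hx hy => simpa only [map_add, add_sub_add_comm] using add_mem hx hy
  | smul c x hx => simpa only [map_smul, ← smul_sub] using Submodule.smul_mem _ c hx

variable (k s) in
/-- The quotient `O[x](n) / (x)^N`. -/
abbrev Trunc (N n : ℕ) (p : ZMod 2) : Type u := FreeOp k s n p ⧸ xIdeal k s N n p

variable (k s) in
/-- The completion `O[[x]](n) = lim_N O[x](n) / (x)^N` (in parity `p`), where `O` is `A_∞` for
`s = false` and `L_∞` for `s = true`: compatible families of elements of the quotients. -/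
def Completed (n : ℕ) (p : ZMod 2) :
    Submodule k ((N : ℕ) → Trunc k s N n p) where
  carrier := {z | ∀ M N, ∀ h : M ≤ N, Submodule.factor (xIdeal_anti h n p) (z N) = z M}
  add_mem' hy hz M N h := by simp [hy M N h, hz M N h]
  zero_mem' M N h := by simp
  smul_mem' c z hz M N h := by simp [hz M N h]

/-- The differential induced on `O[x] / (x)^N` by the derivation with `m_n ↦ δm n` and
`x ↦ ∑_{n=1}^N c_n • m_n ∘ (x ⊗ … ⊗ x)`; the terms of the series with `n ≥ N` lie in `(x)^N`. -/
noncomputable def truncD (δm : ∀ n, 1 ≤ n → FreeOp k s n (1 + 1))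
    (hδ : ∀ hs n hn σ, perm hs σ (δm n hn) = δm n hn) (c : ℕ → k) (N n : ℕ) (p : ZMod 2) :
    Trunc k s N n p →ₗ[k] Trunc k s N n (p + 1) :=
  Submodule.mapQ _ _ (der δm (mcSum c N) hδ n p) (der_mem δm hδ c N n p)

theorem factor_truncD (δm : ∀ n, 1 ≤ n → FreeOp k s n (1 + 1))
    (hδ : ∀ hs n hn σ, perm hs σ (δm n hn) = δm n hn) (c : ℕ → k) {M N : ℕ} (h : M ≤ N)
    {n : ℕ} {p : ZMod 2} (z : Trunc k s N n p) :
    Submodule.factor (xIdeal_anti h n (p + 1)) (truncD δm hδ c N n p z) =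
      truncD δm hδ c M n p (Submodule.factor (xIdeal_anti h n p) z) := by
  obtain ⟨w, rfl⟩ := Submodule.mkQ_surjective _ z
  exact (Submodule.Quotient.eq _).mpr (der_sub_mem δm hδ c h w)

/-- The differential of `O[[x]]`: the continuous derivation with `m_n ↦ δm n` and
`x ↦ ∑_{n=1}^∞ c_n • m_n ∘ (x ⊗ … ⊗ x)`, as the limit of the differentials on `O[x] / (x)^N`. -/
noncomputable def completedD (δm : ∀ n, 1 ≤ n → FreeOp k s n (1 + 1))
    (hδ : ∀ hs n hn σ, perm hs σ (δm n hn) = δm n hn) (c : ℕ → k) (n : ℕ) (p : ZMod 2) :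
    Completed k s n p →ₗ[k] Completed k s n (p + 1) where
  toFun z := ⟨fun N => truncD δm hδ c N n p (z.1 N), fun M N h => by
    rw [factor_truncD δm hδ c h, z.2 M N h]⟩
  map_add' y z := Subtype.ext (funext fun N => map_add _ _ _)
  map_smul' a z := Subtype.ext (funext fun N => map_smul (truncD δm hδ c N n p) a (z.1 N))

theorem comp_sub_comp_mem {a b n N : ℕ} {p q r : ZMod 2} {i : ℕ} (hi : i < a)
    (hn : n + 1 = a + b) (hr : r = p + q) {f f' : FreeOp k s a p} {g g' : FreeOp k s b q}
    (hf : f - f' ∈ xIdeal k s N a p) (hg : g - g' ∈ xIdeal k s N b q) :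
    comp i hi hn hr f g - comp i hi hn hr f' g' ∈ xIdeal k s N n r := by
  have h₁ := comp_mem_xIdeal hi hn hr hf (mem_xIdeal_zero g)
  have h₂ := comp_mem_xIdeal hi hn hr (mem_xIdeal_zero f') hg
  rw [zero_add] at h₂
  have := add_mem h₁ h₂
  simpa using this

/-- Partial composition on `O[x] / (x)^N`. -/
noncomputable def truncComp {a b n : ℕ} {p q r : ZMod 2} (i : ℕ) (hi : i < a)
    (hn : n + 1 = a + b) (hr : r = p + q) (N : ℕ) (f : Trunc k s N a p) (g : Trunc k s N b q) :
    Trunc k s N n r :=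
  Quotient.map₂ (fun f g => comp i hi hn hr f g) (fun _ _ hf _ _ hg =>
    (Submodule.quotientRel_def _).mpr (comp_sub_comp_mem hi hn hr
      ((Submodule.quotientRel_def _).mp hf) ((Submodule.quotientRel_def _).mp hg))) f g

/-- Partial composition on the completed operad `O[[x]]`. -/
noncomputable def completedComp {a b n : ℕ} {p q r : ZMod 2} (i : ℕ) (hi : i < a)
    (hn : n + 1 = a + b) (hr : r = p + q) (f : Completed k s a p) (g : Completed k s b q) :
    Completed k s n r :=
  ⟨fun N => truncComp i hi hn hr N (f.1 N) (g.1 N), fun M N h => by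
    change Submodule.factor _ (truncComp i hi hn hr N (f.1 N) (g.1 N)) =
      truncComp i hi hn hr M (f.1 M) (g.1 M)
    rw [← f.2 M N h, ← g.2 M N h]
    obtain ⟨u, hu⟩ := Submodule.mkQ_surjective _ (f.1 N)
    obtain ⟨v, hv⟩ := Submodule.mkQ_surjective _ (g.1 N)
    rw [← hu, ← hv]
    rfl⟩

/-- Action of the symmetric group on `O[x] / (x)^N`. -/
noncomputable def truncPerm {n : ℕ} {p : ZMod 2} (hs : s = true) (σ : Equiv.Perm (Fin n)) (N : ℕ) :
    Trunc k s N n p →ₗ[k] Trunc k s N n p :=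
  Submodule.mapQ _ _ (perm hs σ) fun f (h : f ∈ xIdeal k s N n p) => perm_mem_xIdeal hs σ h

/-- Action of the symmetric group on the completed symmetric operad `O[[x]]`. -/
noncomputable def completedPerm {n : ℕ} {p : ZMod 2} (hs : s = true) (σ : Equiv.Perm (Fin n))
    (f : Completed k s n p) : Completed k s n p :=
  ⟨fun N => truncPerm hs σ N (f.1 N), fun M N h => by
    change Submodule.factor _ (truncPerm hs σ N (f.1 N)) = truncPerm hs σ M (f.1 M)
    rw [← f.2 M N h]
    obtain ⟨u, hu⟩ := Submodule.mkQ_surjective _ (f.1 N)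
    rw [← hu]
    rfl⟩

variable (k) in
/-- The cobar differential of `A_∞`: `d m_n = ∑_{a=1}^n ∑_{i=1}^a m_a ∘_i m_{n-a+1}`
(in the code `a` and `i` are shifted by one). -/
noncomputable def cobarA (n : ℕ) (_ : 1 ≤ n) : FreeOp k false n (1 + 1) :=
  ∑ a : Fin n, ∑ i : Fin (a + 1),
    comp (a := a + 1) (b := n - a) i i.isLt (by omega) rfl
      (of k (.m (a + 1) (by omega))) (of k (.m (n - a) (by omega)))

/-- `σ ∈ S_n` is an `(l, n - l)`-shuffle: increasing on the first `l` and on the last `n - l` places. -/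
def IsShuffle {n : ℕ} (l : ℕ) (σ : Equiv.Perm (Fin n)) : Prop :=
  ∀ i j : Fin n, i < j → ((j : ℕ) < l ∨ l ≤ (i : ℕ)) → σ i < σ j

open Classical in
variable (k) in
/-- The cobar differential of `L_∞`:
`d m_n = ∑_{a=1}^n ∑_{σ ∈ Sh(n-a+1, a-1)} σ (m_a ∘_1 m_{n-a+1})` (in the code `a` is shifted by
one). -/
noncomputable def cobarL (n : ℕ) (_ : 1 ≤ n) : FreeOp k true n (1 + 1) :=
  ∑ a : Fin n, ∑ σ : Equiv.Perm (Fin n) with IsShuffle (n - a) σ,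
    perm rfl σ (comp (a := a + 1) (b := n - a) 0 (Nat.succ_pos a) (by omega) rfl
      (of k (.m (a + 1) (by omega))) (of k (.m (n - a) (by omega))))

theorem block_ge {n l : ℕ} {β : Equiv.Perm (Fin n)} (hβ : ∀ t : Fin n, (t : ℕ) < l → (β t : ℕ) < l)
    (t : Fin n) : (β t : ℕ) < l ↔ (t : ℕ) < l := by
  refine ⟨fun h => ?_, hβ t⟩
  let S : Finset (Fin n) := Finset.univ.filter fun t => (t : ℕ) < l
  have hS : S.map β.toEmbedding = S :=
    Finset.eq_of_subset_of_card_le (fun u hu => by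
      obtain ⟨v, hv, rfl⟩ := Finset.mem_map.mp hu
      simpa [S] using hβ v (by simpa [S] using hv)) (by simp)
  have hm : β t ∈ S.map β.toEmbedding := by rw [hS]; simpa [S] using h
  simpa [S] using hm

theorem shuffle_unique {n l : ℕ} {σ σ' : Equiv.Perm (Fin n)} (h : IsShuffle l σ)
    (h' : IsShuffle l σ') (hb : ∀ t : Fin n, (t : ℕ) < l → ((σ⁻¹ * σ') t : ℕ) < l) : σ = σ' := by
  have hb' := block_ge hb
  have hm : StrictMono (σ⁻¹ * σ') := by
    intro i j hij
    by_cases hc : (j : ℕ) < l ∨ l ≤ (i : ℕ)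
    · by_contra hle
      have hle : (σ⁻¹ * σ') j ≤ (σ⁻¹ * σ') i := not_lt.mp hle
      have hne : (σ⁻¹ * σ') j ≠ (σ⁻¹ * σ') i := fun e => hij.ne' ((σ⁻¹ * σ').injective e)
      have h1 := h' i j hij hc
      have hij' : (i : ℕ) < j := hij
      have h2 := h _ _ (lt_of_le_of_ne hle hne) (by
        rcases hc with hc | hc
        · left; exact (hb' i).mpr (by omega)
        · right
          have := hb' j
          omega)
      rw [← Equiv.Perm.mul_apply, ← Equiv.Perm.mul_apply, mul_inv_cancel_left] at h2
      exact lt_asymm h1 h2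
    · have h1 := hb' i
      have h2 := hb' j
      rw [Fin.lt_def]
      omega
  have : σ⁻¹ * σ' = 1 := by
    let e : Fin n ≃o Fin n := hm.orderIsoOfSurjective _ (σ⁻¹ * σ').surjective
    have he : e = OrderIso.refl _ := Subsingleton.elim _ _
    ext t
    have : e t = t := by rw [he]; rfl
    exact congrArg Fin.val this
  rw [inv_mul_eq_one] at this
  exact this

theorem shuffle_exists {n l : ℕ} (hl : l ≤ n) (ρ : Equiv.Perm (Fin n)) :
    ∃ σ : Equiv.Perm (Fin n), IsShuffle l σ ∧ ∀ t : Fin n, (t : ℕ) < l → ((σ⁻¹ * ρ) t : ℕ) < l := by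
  obtain ⟨m, rfl⟩ := Nat.exists_eq_add_of_le hl
  let S : Finset (Fin (l + m)) := (Finset.univ.filter fun t : Fin (l + m) => (t : ℕ) < l).map
    ρ.toEmbedding
  have hS : S.card = l := by
    simp only [S, Finset.card_map]
    rw [Fin.card_filter_val_lt]
    omega
  have hS' : Sᶜ.card = m := by
    rw [Finset.card_compl, hS, Fintype.card_fin]; omega
  let e := finSumEquivOfFinset hS hS'
  let σ : Equiv.Perm (Fin (l + m)) := finSumFinEquiv.symm.trans e
  have hσl : ∀ u : Fin l, σ (Fin.castAdd m u) = S.orderEmbOfFin hS u := by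
    intro u; simp [σ, e]
  have hσr : ∀ u : Fin m, σ (Fin.natAdd l u) = Sᶜ.orderEmbOfFin hS' u := by
    intro u; simp [σ, e]
  refine ⟨σ, ?_, ?_⟩
  · intro i j hij hc
    induction i using Fin.addCases with
    | left i =>
      induction j using Fin.addCases with
      | left j =>
        rw [hσl, hσl]
        exact (Finset.orderEmbOfFin _ _).lt_iff_lt.mpr hij
      | right j => simp at hc; omega
    | right i =>
      induction j using Fin.addCases with
      | left j => simp [Fin.lt_def] at hij; omega
      | right j =>
        rw [hσr, hσr]
        exact (Finset.orderEmbOfFin _ _).lt_iff_lt.mpr (by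
          rw [Fin.lt_def, Fin.val_natAdd, Fin.val_natAdd] at hij
          rw [Fin.lt_def]; omega)
  · intro t ht
    have h1 : ρ t ∈ S := by simp [S, ht]
    obtain ⟨u, hu⟩ : ∃ u, S.orderEmbOfFin hS u = ρ t := by
      have := Finset.range_orderEmbOfFin S hS
      have h2 : ρ t ∈ (S : Set _) := h1
      rw [← this] at h2
      exact h2
    rw [Equiv.Perm.mul_apply, ← hu, ← hσl]
    rw [← Equiv.Perm.mul_apply, inv_mul_cancel]
    simp

theorem perm_block {a b n : ℕ} (ha : 0 < a) (hn : n + 1 = a + b) {r : ZMod 2} {p q : ZMod 2}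
    (hr : r = p + q)
    (f : FreeOp k true a p) (g : FreeOp k true b q)
    (hf : ∀ σ, perm rfl σ f = f) (hg : ∀ σ, perm rfl σ g = g)
    (β : Equiv.Perm (Fin n)) (hβ : ∀ t : Fin n, (t : ℕ) < b → (β t : ℕ) < b) :
    perm rfl β (comp 0 ha hn hr f g) = comp 0 ha hn hr f g := by
  have hβ' := block_ge hβ
  let τ : Equiv.Perm (Fin b) := Equiv.ofBijective
    (fun t => ⟨β ⟨t, by omega⟩, hβ _ t.isLt⟩) (Finite.injective_iff_bijective.mp (by
      intro t t' h
      have := β.injective (Fin.ext (Fin.mk.inj_iff.mp h))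
      exact Fin.ext (Fin.mk.inj_iff.mp this)))
  let σ : Equiv.Perm (Fin a) := Equiv.ofBijective
    (fun t => if h : (t : ℕ) = 0 then ⟨0, ha⟩ else
      ⟨β ⟨t + b - 1, by omega⟩ + 1 - b, by
        have := (β ⟨t + b - 1, by omega⟩).isLt
        omega⟩) (Finite.injective_iff_bijective.mp (by
      intro t t' h
      have key : ∀ u (hu : u < n), b ≤ u → b ≤ (β ⟨u, hu⟩ : ℕ) := by
        intro u hu hb
        have := hβ' ⟨u, hu⟩
        simp only at this
        omega
      by_cases h0 : (t : ℕ) = 0 <;> by_cases h0' : (t' : ℕ) = 0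
      · exact Fin.ext (h0.trans h0'.symm)
      · have := key (t' + b - 1) (by omega) (by omega)
        simp [h0, h0', Fin.ext_iff] at h
        omega
      · have := key (t + b - 1) (by omega) (by omega)
        simp [h0, h0', Fin.ext_iff] at h
        omega
      · have h1 := key (t' + b - 1) (by omega) (by omega)
        have h2 := key (t + b - 1) (by omega) (by omega)
        simp only [h0, h0', dite_false, Fin.mk.injEq] at h
        by_contra hne
        have hne : (t : ℕ) ≠ t' := fun e => hne (Fin.ext e)
        exact perm_val_ne β (u := t + b - 1) (v := t' + b - 1) (by omega) (by omega) (by omega)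
          (by omega)))
  have hσ0 : σ ⟨0, ha⟩ = ⟨0, ha⟩ := by simp [σ]
  have hβe : blockPerm 0 ha hn σ τ = β := by
    ext t
    simp only [blockPerm, Equiv.ofBijective_apply, blockFun, hσ0]
    by_cases h : (t : ℕ) < b
    · simp [h, τ]
    · have h1 := hβ' t
      simp [h, σ, show ¬ (t : ℕ) + 1 - b = 0 by omega]
      have h2 : (⟨t + 1 - b + b - 1, by omega⟩ : Fin n) = t := Fin.ext (by simp; omega)
      simp only [h2]
      omega
  have := comp_perm (k := k) rfl 0 ha hn hr σ τ f g
  rw [hf, hg, hβe] at this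
  rw [← this]
  simp only [hσ0]

theorem perm_m {n : ℕ} (hn : 1 ≤ n) (σ : Equiv.Perm (Fin n)) :
    perm rfl σ (of k (.m (s := true) n hn)) = of k (.m n hn) := by
  simpa [sgn_zero] using of_rel (k := k) (.perm_m rfl n hn σ)

theorem perm_cobarL (n : ℕ) (hn : 1 ≤ n) (τ : Equiv.Perm (Fin n)) :
    perm rfl τ (cobarL k n hn) = cobarL k n hn := by
  classical
  rw [cobarL, map_sum]
  refine Finset.sum_congr rfl fun a _ => ?_
  rw [map_sum]
  set u : FreeOp k true n (1 + 1) := comp (a := a + 1) (b := n - a) 0 (Nat.succ_pos a) (by omega)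
    rfl (of k (.m (a + 1) (by omega))) (of k (.m (n - a) (by omega))) with hu
  have hfix : ∀ β : Equiv.Perm (Fin n), (∀ t : Fin n, (t : ℕ) < n - a → (β t : ℕ) < n - a) →
      perm rfl β u = u := fun β hβ =>
    perm_block _ _ _ _ _ (perm_m _) (perm_m _) β hβ
  choose sh hsh hshb using fun ρ => shuffle_exists (l := n - a) (Nat.sub_le n a) ρ
  have inv : ∀ ρ σ : Equiv.Perm (Fin n), IsShuffle (n - a) σ → sh (ρ⁻¹ * sh (ρ * σ)) = σ := by
    intro ρ σ hσ
    refine shuffle_unique (hsh _) hσ fun t ht => ?_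
    have h1 := hshb (ρ⁻¹ * sh (ρ * σ))
    have h2 := block_ge (hshb (ρ * σ))
    have h3 := h1 (((sh (ρ * σ))⁻¹ * (ρ * σ)) t) ((h2 t).mpr ht)
    simpa [mul_assoc] using h3
  refine Finset.sum_nbij' (fun σ => sh (τ * σ)) (fun σ => sh (τ⁻¹ * σ)) ?_ ?_ ?_ ?_ ?_
  · intro σ _; simpa using hsh _
  · intro σ _; simpa using hsh _
  · intro σ hσ; exact inv τ σ (by simpa using hσ)
  · intro σ hσ
    have := inv τ⁻¹ σ (by simpa using hσ)
    simpa using this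
  · intro σ _
    rw [← perm_mul_apply]
    conv_lhs => rw [show τ * σ = sh (τ * σ) * ((sh (τ * σ))⁻¹ * (τ * σ)) by group]
    rw [perm_mul_apply, hfix _ (hshb _)]

/-- A `ℤ/2`-graded collection with an odd operator `d` is acyclic: in every arity and parity the
kernel of `d` equals the image of `d` (in particular `d ∘ d = 0`, and the homology vanishes). -/
def IsAcyclic {C : ℕ → ZMod 2 → Type u} [∀ n p, AddCommGroup (C n p)] [∀ n p, Module k (C n p)]
    (d : ∀ n p, C n p →ₗ[k] C n (p + 1)) : Prop :=
  ∀ n p, Function.Exact (d n p) (d n (p + 1))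

variable (k) in
/-- The operad `𝒜_∞ = A_∞[[x]]` governing `A_∞` algebras with a Maurer-Cartan element, in arity `n`
and parity `p`. -/
abbrev AInfMC (n : ℕ) (p : ZMod 2) : Type u := Completed k false n p

variable (k) in
/-- The differential of `𝒜_∞`: the cobar differential on `A_∞` and
`d x = ∑_{n ≥ 1} m_n ∘ (x ⊗ … ⊗ x)`. -/
noncomputable def AInfMC.d (n : ℕ) (p : ZMod 2) : AInfMC k n p →ₗ[k] AInfMC k n (p + 1) :=
  completedD (cobarA k) (fun hs => absurd hs (by simp)) (fun _ => 1) n p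

variable (k) in
/-- The operad `ℒ_∞ = L_∞[[x]]` governing `L_∞` algebras with a Maurer-Cartan element, in arity `n`
and parity `p`. -/
abbrev LInfMC (n : ℕ) (p : ZMod 2) : Type u := Completed k true n p

variable (k) in
/-- The differential of `ℒ_∞`: the cobar differential on `L_∞` and
`d x = ∑_{n ≥ 1} (1 / n!) m_n ∘ (x ⊗ … ⊗ x)`. -/
noncomputable def LInfMC.d (n : ℕ) (p : ZMod 2) : LInfMC k n p →ₗ[k] LInfMC k n (p + 1) :=
  completedD (cobarL k) (fun _ => perm_cobarL) (fun j => ((j.factorial : ℕ) : k)⁻¹) n p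

end MCOperad

namespace MCOperad

variable {k : Type*} [Field k] {s : Bool}

/-! Let h be the odd map that deletes a root vertex `m 1`: h(m_1 ∘ g) = g, and h vanishes on
monomials with any other root and on the bare generator m_1, since there is no unit to be left over.
It is a contracting homotopy, dh + hd = id. On generators this holds because d(m_n) contains m_1 ∘
m_n exactly once and d(x) contains m_1 ∘ x with coefficient 1, while no other term has root m_1. It
passes to composites by h(f ∘_i g) = h(f) ∘_i g + ε(f) g, where ε is the coefficient of m_1
(`unitCoeff`) and ε ∘ d = 0. As h does not lower the number of x's, it acts on every truncation and
on the limit, so a cycle z equals d(h z). This is `der_strip_add`, completed in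
`isAcyclic_completedD`.

What remains is d² = 0. The square of an odd derivation is a derivation, so generators suffice
(`der_der_mem`). For m_n, the terms of d²(m_n) are nested or parallel composites of three
generators. Nested ones occur once in d(m_a) ∘ m_b and once, with the opposite sign, in m_a ∘
d(m_b); parallel ones cancel in pairs because the generators are odd. For A_∞ this is done on index
sets (`der_cobarA`). For L_∞ everything is written as sums over the whole symmetric group divided by
factorials, so that shuffles disappear and only coefficients are compared (`der_cobarL`);
characteristic zero enters here.

For x, (dm)(x,…,x) and the insertion of dx into m(x,…,x) are both sums of composites m_a ∘_i m_b
filled with x. With truncated series the two sums differ only by terms with at least N copies of x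
(`der_mcSum_mem`), which vanish in the truncation. -/

/-! ### Derivations and transport between equal degrees -/

theorem der_comp (δm : ∀ n, 1 ≤ n → FreeOp k s n (1 + 1)) (δx : FreeOp k s 0 (0 + 1))
    (hδ : ∀ hs n hn σ, perm hs σ (δm n hn) = δm n hn) {a b n : ℕ} {p q r : ZMod 2} (i : ℕ)
    (hi : i < a) (hn : n + 1 = a + b) (hr : r = p + q) (f : FreeOp k s a p) (g : FreeOp k s b q) :
    der δm δx hδ n r (comp i hi hn hr f g) =
      comp i hi hn (by rw [hr]; ring) (der δm δx hδ a p f) g +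
        sgn k p • comp i hi hn (by rw [hr]; ring) f (der δm δx hδ b q g) := by
  induction f using induction_on with
  | zero => simp
  | add x y hx hy => simp only [map_add, LinearMap.add_apply, hx, hy, smul_add]; abel
  | smul c x hx => simp only [map_smul, LinearMap.smul_apply, hx, smul_add, smul_comm c]
  | of f =>
  induction g using induction_on with
  | zero => simp
  | add x y hx hy => simp only [map_add, hx, hy, smul_add]; abel
  | smul c x hx => simp only [map_smul, hx, smul_add, smul_comm c]
  | of g => simp [derMono]

theorem der_perm (δm : ∀ n, 1 ≤ n → FreeOp k s n (1 + 1)) (δx : FreeOp k s 0 (0 + 1))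
    (hδ : ∀ hs n hn σ, perm hs σ (δm n hn) = δm n hn) {n : ℕ} {p : ZMod 2} (hs : s = true)
    (σ : Equiv.Perm (Fin n)) (f : FreeOp k s n p) :
    der δm δx hδ n p (perm hs σ f) = perm hs σ (der δm δx hδ n p f) := by
  induction f using induction_on with
  | zero => simp
  | add x y hx hy => simp only [map_add, hx, hy]
  | smul c x hx => simp only [map_smul, hx]
  | of f => simp [derMono]

/-- Transport between components with equal arities and parities (zero if they differ). -/
noncomputable def recast {b : ℕ} {q : ZMod 2} (n : ℕ) (r : ZMod 2) :
    FreeOp k s b q →ₗ[k] FreeOp k s n r :=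
  if h : b = n ∧ q = r then h.1 ▸ h.2 ▸ LinearMap.id else 0

@[simp] theorem recast_self {n : ℕ} {r : ZMod 2} (f : FreeOp k s n r) : recast n r f = f := by
  simp [recast]

theorem recast_comp_left {a b n : ℕ} {p q r p' r' : ZMod 2} (i : ℕ) (hi : i < a)
    (hn : n + 1 = a + b) (hr : r = p + q) (hr' : r' = p' + q) (hp : p = p')
    (f : FreeOp k s a p) (g : FreeOp k s b q) :
    comp i hi hn hr' (recast a p' f) g = recast n r' (comp i hi hn hr f g) := by
  subst hp; obtain rfl : r' = r := by rw [hr, hr']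
  simp

theorem recast_perm {n : ℕ} {p p' : ZMod 2} (hp : p = p') (hs : s = true)
    (σ : Equiv.Perm (Fin n)) (f : FreeOp k s n p) :
    perm hs σ (recast n p' f) = recast n p' (perm hs σ f) := by
  subst hp; simp

theorem recast_der (δm : ∀ n, 1 ≤ n → FreeOp k s n (1 + 1)) (δx : FreeOp k s 0 (0 + 1))
    (hδ : ∀ hs n hn σ, perm hs σ (δm n hn) = δm n hn) {m n : ℕ} {p p' : ZMod 2} (hm : m = n)
    (hp : p = p') (f : FreeOp k s m p) :
    der δm δx hδ n p' (recast n p' f) = recast n (p' + 1) (der δm δx hδ m p f) := by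
  subst hp hm; simp

/-! ### The coefficient of the generator m_1 -/

variable (k) in
/-- The coefficient of a single generator `m 1`, on monomials. -/
def unitMono : {n : ℕ} → {p : ZMod 2} → Mono s n p → k
  | _, _, .m n _ => if n = 1 then 1 else 0
  | _, _, .x => 0
  | _, _, .comp _ _ _ _ _ _ => 0
  | _, _, .perm _ _ f => unitMono f

theorem unitMono_rel {n : ℕ} {p e : ZMod 2} {f f' : Mono s n p} (h : Rel e f f') :
    unitMono k f = sgn k e • unitMono k f' := by
  induction h <;> simp_all [unitMono, sgn_zero]

/-- The coefficient of the generator `m 1`. -/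
noncomputable def unitCoeff {n : ℕ} {p : ZMod 2} : FreeOp k s n p →ₗ[k] k :=
  liftOp (unitMono k) fun _ _ _ h => unitMono_rel h

/-- Only m_1, possibly permuted, has nonzero coefficient. In f ∘_i g this forces g to have the
degree in which `recast` is the identity rather than zero. -/
theorem unitMono_ne_zero {n : ℕ} {p : ZMod 2} {f : Mono s n p} (h : unitMono k f ≠ 0) :
    n = 1 ∧ p = 1 ∧ f.weight = 0 := by
  induction f with
  | m n hn => simp_all [unitMono, Mono.weight]
  | x => simp [unitMono] at h
  | comp => simp [unitMono] at h
  | perm hs σ f ih => exact ih h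

theorem unitCoeff_eq_zero {n : ℕ} {p : ZMod 2} (h : ¬(n = 1 ∧ p = 1)) (f : FreeOp k s n p) :
    unitCoeff f = 0 := by
  suffices unitCoeff (k := k) (s := s) (n := n) (p := p) = 0 by simp [this]
  refine hom_ext fun f => ?_
  by_contra hf
  have hf' : unitMono k f ≠ 0 := by simpa [unitCoeff] using hf
  exact h ⟨(unitMono_ne_zero hf').1, (unitMono_ne_zero hf').2.1⟩

-- Without an operadic unit, m_1 is indecomposable.
@[simp] theorem unitCoeff_comp {a b n : ℕ} {p q r : ZMod 2} (i : ℕ) (hi : i < a)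
    (hn : n + 1 = a + b) (hr : r = p + q) (f : FreeOp k s a p) (g : FreeOp k s b q) :
    unitCoeff (comp i hi hn hr f g) = 0 := by
  induction f using induction_on with
  | zero => simp
  | add x y hx hy => simp [hx, hy]
  | smul c x hx => simp [hx]
  | of f =>
  induction g using induction_on with
  | zero => simp
  | add x y hx hy => simp [hx, hy]
  | smul c x hx => simp [hx]
  | of g => simp [unitCoeff, unitMono]

@[simp] theorem unitCoeff_perm {n : ℕ} {p : ZMod 2} (hs : s = true) (σ : Equiv.Perm (Fin n))
    (f : FreeOp k s n p) : unitCoeff (perm hs σ f) = unitCoeff f := by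
  induction f using induction_on with
  | zero => simp
  | add x y hx hy => simp [hx, hy]
  | smul c x hx => simp [hx]
  | of f => simp [unitCoeff, unitMono]

/-! ### The contracting homotopy -/

/-- The homotopy removing a root vertex `m 1`, evaluated on monomials. The root vertex `m 1` of
`m 1` itself is not removed, as there is no operadic unit. -/
noncomputable def stripMono : {n : ℕ} → {p : ZMod 2} → Mono s n p → (r : ZMod 2) →
    r = p + 1 → FreeOp k s n r
  | _, _, .m _ _, _, _ => 0
  | _, _, .x, _, _ => 0
  | _, _, .comp (n := n) (p := p) i hi hn hr f g, t, ht =>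
      -- The root lies in the left factor, so the homotopy moves past nothing and no Koszul sign
      -- appears. The second summand is the case where f is m_1 itself.
      comp i hi hn (by rw [ht, hr]; ring) (stripMono f (p + 1) rfl) (of k g) +
        unitMono k f • recast n t (of k g)
  | _, _, .perm hs σ f, t, ht => perm hs σ (stripMono f t ht)

theorem blockPerm_of_eq_one {b n : ℕ} {i : ℕ} (hi : i < 1) (hn : n + 1 = 1 + b) (hb : b = n)
    (σ : Equiv.Perm (Fin 1)) (τ : Equiv.Perm (Fin b)) (t : Fin n) :
    (blockPerm i hi hn σ τ t : ℕ) = τ (t.cast hb.symm) := by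
  subst hb
  obtain rfl : i = 0 := by omega
  simp [blockPerm, blockFun]

theorem stripMono_rel {n : ℕ} {p e : ZMod 2} {f f' : Mono s n p} (h : Rel e f f')
    (t : ZMod 2) (ht : t = p + 1) :
    stripMono (k := k) f t ht = sgn k e • stripMono f' t ht := by
  induction h generalizing t with
  | @seq a b c n₁ n₂ n p q r p₁ p₂ p₃ i j hi hj h₁ h₂ h₃ h₄ hij e₁ e₂ e₃ e₄ f g h =>
    simp only [stripMono, unitMono, zero_smul, add_zero, map_add, LinearMap.add_apply, sgn_zero,
      one_smul, map_smul, LinearMap.smul_apply, ← comp_of]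
    rw [comp_seq (p₂ := p₂) hi hj h₁ h₂ h₃ h₄ hij _ _ e₃ (by rw [ht, e₄]; ring)]
    congr 1
    -- If f has nonzero coefficient, then it has arity 1 and is odd; deleting it leaves g ∘_j h on
    -- both sides.
    by_cases hu : unitMono k f = 0
    · simp [hu]
    obtain ⟨rfl, rfl, -⟩ := unitMono_ne_zero hu
    obtain rfl : n₁ = b := by omega
    obtain rfl : n₂ = n := by omega
    obtain rfl : i = 0 := by omega
    congr 1
    have hq : q = p₁ + 1 := by rw [e₁, add_right_comm, show (1 + 1 : ZMod 2) = 0 from rfl, zero_add]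
    have hp : p₂ = t := by rw [ht, e₄, add_right_comm, show (1 + 1 : ZMod 2) = 0 from rfl, zero_add]
    subst hq hp
    simp
  | @par a b c n₁ n₂ n p q r p₁ p₂ p₃ i j l hi hj hij hl h₁ h₂ h₃ h₄ hl' hi' e₁ e₂ e₃ e₄ f g h =>
    -- Two distinct inputs i < j are used, so f is not of arity 1.
    have hu : unitMono k f = 0 := by
      by_contra hu
      have := (unitMono_ne_zero hu).1
      omega
    simp only [stripMono, unitMono, zero_smul, add_zero, hu]
    exact comp_par hi hj hij hl h₁ h₂ h₃ h₄ hl' hi' _ _ _ _ _ _ _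
  | perm_one hs f => simp [stripMono, perm_one_apply, sgn_zero]
  | perm_mul hs σ τ f => simp [stripMono, perm_mul_apply, sgn_zero]
  | @perm_comp a b n p q r hs i hi hn hr σ τ f g =>
    simp only [stripMono, unitMono, ← perm_of, sgn_zero, one_smul, map_add, map_smul, comp_perm]
    congr 1
    by_cases hu : unitMono k f = 0
    · simp [hu]
    obtain ⟨rfl, rfl, -⟩ := unitMono_ne_zero hu
    obtain rfl : b = n := by omega
    obtain rfl : q = t := by
      rw [ht, hr, add_right_comm, show (1 + 1 : ZMod 2) = 0 from rfl, zero_add]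
    rw [show blockPerm i hi hn σ τ = τ from
      Equiv.ext fun t => Fin.ext (blockPerm_of_eq_one hi hn rfl σ τ t)]
    simp
  | perm_m hs n hn σ => simp [stripMono]
  | comp_left i hi hn hr g h ih =>
    simp only [stripMono, ih, unitMono_rel h, map_smul, LinearMap.smul_apply, smul_add, smul_smul,
      smul_eq_mul]
  | comp_right i hi hn hr f h ih =>
    simp only [stripMono, of_rel h, map_smul, smul_add, smul_comm (sgn k _)]
  | perm_congr hs σ h ih => simp only [stripMono, ih, map_smul]

/-- The homotopy removing a root vertex `m 1`. -/
noncomputable def strip (n : ℕ) (p r : ZMod 2) (hr : r = p + 1) :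
    FreeOp k s n p →ₗ[k] FreeOp k s n r :=
  liftOp (fun f => stripMono f r hr) fun _ _ _ h => stripMono_rel h r hr

@[simp] theorem strip_of {n : ℕ} {p r : ZMod 2} (hr : r = p + 1) (f : Mono s n p) :
    strip n p r hr (of k f) = stripMono f r hr := by
  simp [strip]

theorem strip_comp {a b n : ℕ} {p q r t : ZMod 2} (i : ℕ) (hi : i < a)
    (hn : n + 1 = a + b) (hr : r = p + q) (ht : t = r + 1) (f : FreeOp k s a p)
    (g : FreeOp k s b q) :
    strip n r t ht (comp i hi hn hr f g) =
      comp i hi hn (by rw [ht, hr]; ring) (strip a p (p + 1) rfl f) g +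
        unitCoeff f • recast n t g := by
  induction f using induction_on with
  | zero => simp
  | add x y hx hy => simp only [map_add, LinearMap.add_apply, hx, hy, add_smul]; abel
  | smul c x hx => simp only [map_smul, LinearMap.smul_apply, hx, smul_add, smul_smul, smul_eq_mul]
  | of f =>
  induction g using induction_on with
  | zero => simp
  | add x y hx hy => simp only [map_add, hx, hy, smul_add]; abel
  | smul c x hx => simp only [map_smul, hx, smul_add, smul_comm c]
  | of g => simp [stripMono, unitCoeff]

theorem strip_perm {n : ℕ} {p r : ZMod 2} (hr : r = p + 1) (hs : s = true)
    (σ : Equiv.Perm (Fin n)) (f : FreeOp k s n p) :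
    strip n p r hr (perm hs σ f) = perm hs σ (strip n p r hr f) := by
  induction f using induction_on with
  | zero => simp
  | add x y hx hy => simp only [map_add, hx, hy]
  | smul c x hx => simp only [map_smul, hx]
  | of f => simp [stripMono]

theorem stripMono_mem {n : ℕ} {p r : ZMod 2} (hr : r = p + 1) (f : Mono s n p) :
    stripMono (k := k) f r hr ∈ xIdeal k s f.weight n r := by
  induction f generalizing r with
  | m n hn => exact zero_mem _
  | x => exact zero_mem _
  | @comp a b n p q p' i hi hn hp f g hf hg =>
    refine add_mem (comp_mem_xIdeal _ _ _ (hf rfl) (of_mem_xIdeal g le_rfl)) ?_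
    by_cases hu : unitMono k f = 0
    · simp [hu]
    obtain ⟨rfl, rfl, hw⟩ := unitMono_ne_zero hu
    obtain rfl : b = n := by omega
    obtain rfl : q = r := by
      rw [hr, hp, add_right_comm, show (1 + 1 : ZMod 2) = 0 from rfl, zero_add]
    refine Submodule.smul_mem _ _ ?_
    rw [recast_self]
    exact of_mem_xIdeal g (by simp [Mono.weight, hw])
  | perm hs σ f hf => exact perm_mem_xIdeal hs σ (hf hr)

theorem strip_mem (N n : ℕ) (p r : ZMod 2) (hr : r = p + 1) :
    xIdeal k s N n p ≤ (xIdeal k s N n r).comap (strip n p r hr) := by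
  rw [xIdeal, Submodule.span_le]
  rintro _ ⟨f, hf, rfl⟩
  simpa using xIdeal_anti hf _ _ (stripMono_mem hr f)

/-- Inserting x changes neither the root nor, after the first insertion, the vanishing of the
coefficient of m_1, so nothing becomes removable. -/
theorem strip_plugX {j : ℕ} {p : ZMod 2} (f : FreeOp k s j p)
    (hs : ∀ r hr, strip j p r hr f = 0) (hu : unitCoeff f = 0) (r : ZMod 2) (hr : r = p + 1) :
    strip 0 p r hr (plugX j f) = 0 := by
  induction j with
  | zero => exact hs r hr
  | succ j ih =>
    refine ih _ (fun r hr => ?_) (by simp)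
    simp [strip_comp, hs, hu]

/-- Only m_1 ∘ x has root m_1; the condition `1 ≤ N` keeps this term in the partial sum. -/
theorem strip_mcSum (c : ℕ → k) (hc : c 1 = 1) {N : ℕ} (hN : 1 ≤ N) (r : ZMod 2)
    (hr : r = 0 + 1 + 1) :
    strip 0 (0 + 1) r hr (mcSum (s := s) c N) = recast 0 r (of k (.x : Mono s 0 0)) := by
  rw [mcSum, map_sum, Finset.sum_eq_single_of_mem 0 (Finset.mem_range.mpr hN)]
  · simp only [zero_add, hc, one_smul, plugX]
    rw [strip_comp]
    simp [unitCoeff, unitMono, stripMono]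
  · intro j _ hj
    rw [map_smul]
    refine smul_eq_zero_of_right _ (strip_plugX _ (fun r hr => ?_) ?_ r hr)
    · simp [stripMono]
    · simp [unitCoeff, unitMono, hj]

/-- A derivation sends composites to sums of composites, which do not contain m_1, so only its
values on generators matter; that on x has arity 0. -/
theorem unitCoeff_der (δm : ∀ n, 1 ≤ n → FreeOp k s n (1 + 1)) (δx : FreeOp k s 0 (0 + 1))
    (hδ : ∀ hs n hn σ, perm hs σ (δm n hn) = δm n hn)
    (hu : ∀ n hn, unitCoeff (δm n hn) = 0) {n : ℕ} {p : ZMod 2} (f : Mono s n p) :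
    unitCoeff (der δm δx hδ n p (of k f)) = 0 := by
  induction f with
  | m n hn => simp [derMono, hu]
  | x => exact unitCoeff_eq_zero (by simp) _
  | comp i hi hn hr f g => rw [← comp_of, der_comp]; simp
  | perm hs σ f ih => rw [← perm_of, der_perm, unitCoeff_perm, ih]

theorem sgn_mul_unitCoeff {n : ℕ} {p : ZMod 2} (f : FreeOp k s n p) :
    sgn k p * unitCoeff f = -unitCoeff f := by
  rcases zmod2_cases p with rfl | rfl
  · simp [unitCoeff_eq_zero (p := 0) (by simp) f]
  · simp [sgn_one]

/-- If `δm n` is `m_1 ∘ m_n` modulo monomials whose root is not `m_1`, and `c 1 = 1`, then `strip`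
is a contracting homotopy. -/
theorem der_strip_add (δm : ∀ n, 1 ≤ n → FreeOp k s n (1 + 1))
    (hδ : ∀ hs n hn σ, perm hs σ (δm n hn) = δm n hn)
    (hu : ∀ n hn, unitCoeff (δm n hn) = 0)
    (hm : ∀ n hn r hr, strip n (1 + 1) r hr (δm n hn) = recast n r (of k (.m n hn)))
    (c : ℕ → k) (hc : c 1 = 1) {N : ℕ} (hN : 1 ≤ N) {n : ℕ} {p : ZMod 2}
    (f : FreeOp k s n p) (r : ZMod 2) (hr : r = p + 1) :
    der δm (mcSum c N) hδ n r (strip n p r hr f) +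
      strip n (p + 1) (r + 1) (by rw [hr]) (der δm (mcSum c N) hδ n p f) =
        recast n (r + 1) f := by
  induction f using induction_on with
  | zero => simp
  | add x y hx hy => simp only [map_add, ← hx, ← hy]; abel
  | smul c x hx => simp only [map_smul, ← hx, smul_add]
  | of f =>
  induction f generalizing r with
  | m n hn => simp [derMono, stripMono, hm]
  | x => simp [derMono, stripMono, strip_mcSum c hc hN]
  | @comp a b n p q p' i hi hn hp f g hf hg =>
    have e : ∀ p : ZMod 2, p + 1 + 1 = p := fun p => by
      rw [add_assoc, show (1 + 1 : ZMod 2) = 0 from rfl, add_zero]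
    -- The transport commutes with d only when the degrees agree, which holds where the coefficient
    -- can be nonzero.
    have h₁ : unitCoeff (of k f) • der δm (mcSum c N) hδ n r (recast n r (of k g)) =
        unitCoeff (of k f) • recast n (r + 1) (der δm (mcSum c N) hδ b q (of k g)) := by
      by_cases h : a = 1 ∧ p = 1
      · rw [recast_der δm _ hδ (by omega)]
        rw [hr, hp, h.2, add_comm 1 q, e]
      · simp [unitCoeff_eq_zero h]
    have h₂ := recast_comp_left (p' := p + 1 + 1) (r' := r + 1) i hi hn hp (by rw [hr, hp]; ring)
      (e p).symm (of k f) (of k g)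
    rw [← hf (p + 1) rfl, map_add, LinearMap.add_apply] at h₂
    -- The terms h(f) ∘ dg come with signs of |f| + 1 and |f| and cancel. So do the terms ε(f) dg,
    -- because ε(f) ≠ 0 only for odd f. What is left is (dh + hd)(f) ∘ g.
    rw [← comp_of, ← h₂, strip_comp, map_add, map_smul, der_comp, der_comp, map_add, map_smul,
      strip_comp, strip_comp, unitCoeff_der δm _ hδ hu, h₁]
    simp only [zero_smul, add_zero, smul_add, smul_smul, sgn_mul_unitCoeff, neg_smul, sgn_add,
      sgn_one, mul_neg, mul_one]
    abel
  | perm hs σ f hf =>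
    rw [← perm_of, strip_perm, der_perm, der_perm, strip_perm, ← map_add, hf,
      recast_perm (by rw [hr, add_assoc, show (1 + 1 : ZMod 2) = 0 from rfl, add_zero])]

/-! ### Passage to the completion -/

/-- The homotopy on `O[x] / (x)^N`. -/
noncomputable def truncStrip (N n : ℕ) (p r : ZMod 2) (hr : r = p + 1) :
    Trunc k s N n p →ₗ[k] Trunc k s N n r :=
  Submodule.mapQ _ _ (strip n p r hr) (strip_mem N n p r hr)

theorem truncD_truncStrip (δm : ∀ n, 1 ≤ n → FreeOp k s n (1 + 1))
    (hδ : ∀ hs n hn σ, perm hs σ (δm n hn) = δm n hn)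
    (hu : ∀ n hn, unitCoeff (δm n hn) = 0)
    (hm : ∀ n hn r hr, strip n (1 + 1) r hr (δm n hn) = recast n r (of k (.m n hn)))
    (c : ℕ → k) (hc : c 1 = 1) {N : ℕ} {n : ℕ} {r : ZMod 2}
    (z : Trunc k s N n (r + 1)) (hz : truncD δm hδ c N n (r + 1) z = 0) (hr : r = r + 1 + 1) :
    truncD δm hδ c N n r (truncStrip N n (r + 1) r hr z) = z := by
  obtain ⟨w, rfl⟩ := Submodule.mkQ_surjective _ z
  change Submodule.Quotient.mk (der δm (mcSum c N) hδ n r (strip n (r + 1) r hr w)) =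
    Submodule.Quotient.mk w
  have hz' : der δm (mcSum c N) hδ n (r + 1) w ∈ xIdeal k s N n (r + 1 + 1) :=
    (Submodule.Quotient.mk_eq_zero _).mp hz
  rw [Submodule.Quotient.eq]
  -- For N = 0 the truncated dx is an empty sum and the homotopy identity is unavailable, but the
  -- quotient is zero.
  rcases Nat.eq_zero_or_pos N with rfl | hN
  · exact mem_xIdeal_zero _
  have h := der_strip_add δm hδ hu hm c hc hN w r hr
  rw [recast_self] at h
  rw [← eq_sub_iff_add_eq] at h
  rw [h, sub_sub_cancel_left]
  exact neg_mem (strip_mem N n _ _ _ hz')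

/-- The cross terms df ∘ dg in d²(f ∘ g) have opposite signs, so d² is determined by generators. The
statement is modulo (x)^N because d²(x) vanishes only to that order when dx is truncated. -/
theorem der_der_mem (δm : ∀ n, 1 ≤ n → FreeOp k s n (1 + 1))
    (hδ : ∀ hs n hn σ, perm hs σ (δm n hn) = δm n hn) (δx : FreeOp k s 0 (0 + 1)) (N : ℕ)
    (hm : ∀ n hn, der δm δx hδ n (1 + 1) (δm n hn) ∈ xIdeal k s N n (1 + 1 + 1))
    (hx : der δm δx hδ 0 (0 + 1) δx ∈ xIdeal k s N 0 (0 + 1 + 1)) {n : ℕ} {p : ZMod 2}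
    (f : FreeOp k s n p) :
    der δm δx hδ n (p + 1) (der δm δx hδ n p f) ∈ xIdeal k s N n (p + 1 + 1) := by
  induction f using induction_on with
  | zero => simp
  | add x y hx hy => simp only [map_add]; exact add_mem hx hy
  | smul c x hx => simp only [map_smul]; exact Submodule.smul_mem _ _ hx
  | of f =>
  induction f with
  | m n hn => simpa [derMono] using hm n hn
  | x => simpa [derMono] using hx
  | @comp a b n p q r i hi hn hr f g hf hg =>
    rw [← comp_of]
    simp only [der_comp, map_add, map_smul, smul_add, smul_smul, sgn_add, sgn_one]
    have h₁ := comp_mem_xIdeal hi hn (show r + 1 + 1 = p + 1 + 1 + q by rw [hr]; ring) hf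
      (mem_xIdeal_zero (of k g))
    have h₂ := comp_mem_xIdeal hi hn (show r + 1 + 1 = p + (q + 1 + 1) by rw [hr]; ring) (mem_xIdeal_zero (of k f)) hg
    rw [zero_add] at h₂
    rw [add_zero] at h₁
    convert add_mem h₁ h₂ using 1
    rw [← sgn_add, CharTwo.add_self_eq_zero, sgn_zero]
    simp
  | perm hs σ f ih =>
    rw [← perm_of, der_perm, der_perm]
    exact perm_mem_xIdeal hs σ ih

/-- The homotopy gives primitives at every level N that are compatible with the projections, so they
assemble in the limit with no lim¹ argument. -/
theorem isAcyclic_completedD (δm : ∀ n, 1 ≤ n → FreeOp k s n (1 + 1))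
    (hδ : ∀ hs n hn σ, perm hs σ (δm n hn) = δm n hn)
    (hu : ∀ n hn, unitCoeff (δm n hn) = 0)
    (hm : ∀ n hn r hr, strip n (1 + 1) r hr (δm n hn) = recast n r (of k (.m n hn)))
    (c : ℕ → k) (hc : c 1 = 1)
    (hdm : ∀ n hn δx, der δm δx hδ n (1 + 1) (δm n hn) = 0)
    (hdx : ∀ N, der δm (mcSum c N) hδ 0 (0 + 1) (mcSum c N) ∈ xIdeal k s N 0 (0 + 1 + 1)) :
    IsAcyclic (C := fun n p => Completed k s n p) (completedD δm hδ c) := by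
  intro n p z
  constructor
  · intro hz
    have hr : p = p + 1 + 1 := by
      rw [add_assoc, show (1 + 1 : ZMod 2) = 0 from rfl, add_zero]
    refine ⟨⟨fun N => truncStrip N n (p + 1) p hr (z.1 N), fun M N h => ?_⟩, ?_⟩
    · change _ = truncStrip M n (p + 1) p hr (z.1 M)
      rw [← z.2 M N h]
      change Submodule.factor _ (truncStrip N n (p + 1) p hr (z.1 N)) = _
      obtain ⟨u, hu⟩ := Submodule.mkQ_surjective _ (z.1 N)
      rw [← hu]
      rfl
    · refine Subtype.ext (funext fun N => ?_)
      exact truncD_truncStrip δm hδ hu hm c hc _ (congrFun (congrArg Subtype.val hz) N) hr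
  · rintro ⟨y, rfl⟩
    refine Subtype.ext (funext fun N => ?_)
    change truncD δm hδ c N n (p + 1) (truncD δm hδ c N n p (y.1 N)) = 0
    obtain ⟨w, hw⟩ := Submodule.mkQ_surjective _ (y.1 N)
    rw [← hw]
    refine (Submodule.Quotient.mk_eq_zero _).mpr
      (der_der_mem δm hδ (mcSum c N) N (fun n hn => ?_) (hdx N) w)
    rw [hdm]
    exact zero_mem _

/-! ### Filling all inputs with x -/

/-- `plugX` as a linear map. -/
noncomputable def plugL (j : ℕ) (p : ZMod 2) : FreeOp k s j p →ₗ[k] FreeOp k s 0 p where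
  toFun := plugX j
  map_add' f g := by
    induction j with
    | zero => rfl
    | succ j ih => simp [plugX, ih]
  map_smul' c f := by
    induction j with
    | zero => rfl
    | succ j ih => simp [plugX, ih]

theorem plugL_apply (j : ℕ) (p : ZMod 2) (f : FreeOp k s j p) : plugL j p f = plugX j f := rfl

/-- Since i is not the last input of f, the last input of the composite is that of f, and parallel
associativity applies; its sign is trivial as x is even. -/
theorem comp_comp_x {j n b : ℕ} {i : ℕ} {p q r : ZMod 2} (hi : i < j + 1) (hi' : i < j + 1 + 1)
    (hn : n + 1 + 1 = (j + 1 + 1) + b) (hn' : n + 1 = (j + 1) + b) (hr : r = p + q)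
    (f : FreeOp k s (j + 1 + 1) p) (g : FreeOp k s b q) :
    comp (n := n) (b := 0) n (Nat.lt_succ_self n) rfl (add_zero r).symm (comp i hi' hn hr f g)
        (of k .x) =
      comp i hi hn' hr
        (comp (n := j + 1) (b := 0) (j + 1) (Nat.lt_succ_self _) rfl (add_zero p).symm f (of k .x))
        g := by
  rw [comp_par (j := j + 1) (n := n) (n₁ := n + 1) (n₂ := j + 1) (p₂ := p) hi' (by omega) hi hn' hn
    rfl rfl hn' (by omega) hi hr _ (add_zero p).symm hr, mul_zero, sgn_zero, one_smul]

theorem plugX_comp_last {j b n : ℕ} {p q r : ZMod 2} (hn : n + 1 = (j + 1) + b) (hr : r = p + q)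
    (f : FreeOp k s (j + 1) p) (g : FreeOp k s b q) :
    plugX n (comp j (Nat.lt_succ_self j) hn hr f g) =
      plugX j (comp (n := j) (b := 0) j (Nat.lt_succ_self j) rfl hr f (plugX b g)) := by
  induction b generalizing n with
  | zero =>
    obtain rfl : n = j := by omega
    rfl
  | succ b ih =>
    obtain rfl : n = j + b + 1 := by omega
    rw [plugX, plugX, ← ih (n := j + b) (by omega),
      comp_seq (n₂ := b) (p₂ := q) _ (Nat.lt_succ_self b) _ _ rfl (by omega) _ _ _
        (add_zero q).symm hr]

theorem plugX_comp {j b n : ℕ} {p q r : ZMod 2} {i : ℕ} (hi : i < j + 1)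
    (hn : n + 1 = (j + 1) + b) (hr : r = p + q)
    (f : FreeOp k s (j + 1) p) (g : FreeOp k s b q) :
    plugX n (comp i hi hn hr f g) =
      plugX j (comp (n := j) (b := 0) i hi rfl hr f (plugX b g)) := by
  induction j generalizing n i with
  | zero =>
    obtain rfl : i = 0 := by omega
    exact plugX_comp_last hn hr f g
  | succ j ih =>
    by_cases hij : i = j + 1
    · subst hij
      exact plugX_comp_last hn hr f g
    obtain ⟨n, rfl⟩ : ∃ m, n = m + 1 := ⟨n - 1, by omega⟩
    rw [plugX, plugX, comp_comp_x (by omega) hi hn (by omega), ih,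
      comp_comp_x (n := j) (b := 0) (by omega) hi rfl rfl]

/-- The order of the insertions is immaterial, as x is even. -/
theorem plugX_comp_x {j : ℕ} {p : ZMod 2} {i : ℕ} (hi : i < j + 1) (f : FreeOp k s (j + 1) p) :
    plugX j (comp (n := j) (b := 0) i hi rfl (add_zero p).symm f (of k .x)) = plugX (j + 1) f := by
  induction j generalizing i with
  | zero =>
    obtain rfl : i = 0 := by omega
    rfl
  | succ j ih =>
    by_cases hij : i = j + 1
    · subst hij
      rfl
    rw [plugX, comp_comp_x (n := j) (b := 0) (by omega) hi rfl rfl, ih]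
    rfl

theorem plugX_perm {n : ℕ} {p : ZMod 2} (hs : s = true) (σ : Equiv.Perm (Fin n))
    (f : FreeOp k s n p) : plugX n (perm hs σ f) = plugX n f := by
  induction n with
  | zero => rw [Subsingleton.elim σ 1, perm_one_apply]
  | succ n ih =>
    -- The input that σ sends to the last place: by equivariance, inserting x last into σf is
    -- inserting it there into f.
    have h := comp_perm (n := n) (b := 0) hs (σ⁻¹ (Fin.last n) : Fin (n + 1))
      (σ⁻¹ (Fin.last n)).isLt rfl (add_zero p).symm σ 1 f (of k .x)
    rw [perm_one_apply] at h
    simp only [Fin.eta, show σ (σ⁻¹ (Fin.last n)) = Fin.last n by simp, Fin.val_last] at h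
    rw [plugX, h, ih, plugX_comp_x]

/-- Leibniz rule: because x is even, every term with dx carries only the sign of moving d past f. -/
theorem der_plugX (δm : ∀ n, 1 ≤ n → FreeOp k s n (1 + 1)) (δx : FreeOp k s 0 (0 + 1))
    (hδ : ∀ hs n hn σ, perm hs σ (δm n hn) = δm n hn) {j : ℕ} {p : ZMod 2}
    (f : FreeOp k s (j + 1) p) :
    der δm δx hδ 0 p (plugX (j + 1) f) = plugX (j + 1) (der δm δx hδ (j + 1) p f) +
      sgn k p • ∑ i : Fin (j + 1), plugX j (comp (n := j) (b := 0) i i.isLt rfl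
        (show p + 1 = p + (0 + 1) by rw [zero_add]) f δx) := by
  induction j with
  | zero =>
    simp [plugX, der_comp, derMono]
  | succ j ih =>
    rw [plugX, ih, der_comp, der_of, derMono, ← plugL_apply, map_add, map_smul, plugL_apply,
      plugL_apply, Fin.sum_univ_castSucc (n := j + 1), smul_add, add_assoc,
      add_comm (sgn k p • plugX (j + 1) _)]
    refine congrArg₂ _ rfl (congrArg₂ _ ?_ rfl)
    refine congrArg _ (Finset.sum_congr rfl fun i _ => ?_)
    exact congrArg _ (comp_comp_x (n := j) (b := 0) i.isLt _ rfl rfl _ _ _).symm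

/-! ### Composites of two generators and d²(x) -/

/-- The generator `m (n + 1)`. -/
noncomputable def gen (k : Type*) [Field k] (s : Bool) (n : ℕ) : FreeOp k s (n + 1) 1 :=
  of k (.m (n + 1) (Nat.le_add_left 1 n))

/-- The composite `m (a + 1) ∘_i m (b + 1)` if it makes sense and has arity `n + 1`. -/
noncomputable def genComp (k : Type*) [Field k] (s : Bool) (n a b i : ℕ) :
    FreeOp k s (n + 1) (1 + 1) :=
  if h : i ≤ a ∧ a + b = n then
    comp i (Nat.lt_succ_of_le h.1) (by omega) rfl (gen k s a) (gen k s b) else 0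

theorem genComp_eq {n a b i : ℕ} (hi : i < a + 1) (hn : n + 1 + 1 = a + 1 + (b + 1)) :
    genComp k s n a b i = comp i hi hn rfl (gen k s a) (gen k s b) :=
  dif_pos ⟨by omega, by omega⟩

theorem sum_range_antidiagonal {M : Type*} [AddCommMonoid M] (N : ℕ) (G : ℕ → ℕ → M) :
    ∑ n ∈ Finset.range N, ∑ x ∈ Finset.HasAntidiagonal.antidiagonal n, G x.1 x.2 =
      ∑ x ∈ Finset.range N ×ˢ Finset.range N with x.1 + x.2 < N, G x.1 x.2 := by
  rw [← Finset.sum_fiberwise_of_maps_to (t := Finset.range N) (g := fun x : ℕ × ℕ => x.1 + x.2)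
    (fun x hx => by simpa using (Finset.mem_filter.mp hx).2)]
  refine Finset.sum_congr rfl fun n hn => Finset.sum_congr ?_ fun _ _ => rfl
  ext x
  simp only [Finset.mem_range] at hn
  simp only [Finset.mem_filter, Finset.mem_product, Finset.mem_range,
    Finset.HasAntidiagonal.mem_antidiagonal]
  omega

/-- The hypothesis `h` matches the coefficients of (dm)(x,…,x) with those arising when dx is
inserted into m(x,…,x). It makes d²(x) vanish up to the effect of truncation. -/
theorem der_mcSum_mem (δm : ∀ n, 1 ≤ n → FreeOp k s n (1 + 1))
    (hδ : ∀ hs n hn σ, perm hs σ (δm n hn) = δm n hn) (c : ℕ → k)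
    (h : ∀ n, c (n + 1) • plugX (n + 1) (δm (n + 1) (Nat.le_add_left 1 n)) =
      ∑ x ∈ Finset.HasAntidiagonal.antidiagonal n, ∑ i ∈ Finset.range (x.1 + 1),
        (c (x.1 + 1) * c (x.2 + 1)) • plugX (n + 1) (genComp k s n x.1 x.2 i)) (N : ℕ) :
    der δm (mcSum c N) hδ 0 (0 + 1) (mcSum c N) ∈ xIdeal k s N 0 (0 + 1 + 1) := by
  set G : ℕ → ℕ → FreeOp k s 0 (1 + 1) := fun a b => ∑ i ∈ Finset.range (a + 1),
    (c (a + 1) * c (b + 1)) • plugX (a + b + 1) (genComp k s (a + b) a b i) with hG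
  have h₁ : ∀ n, c (n + 1) • plugX (n + 1) (δm (n + 1) (Nat.le_add_left 1 n)) =
      ∑ x ∈ Finset.HasAntidiagonal.antidiagonal n, G x.1 x.2 := fun n => by
    rw [h]
    refine Finset.sum_congr rfl fun x hx => ?_
    obtain rfl := Finset.HasAntidiagonal.mem_antidiagonal.mp hx
    rfl
  have h₂ : ∀ j, c (j + 1) • ∑ i : Fin (j + 1), plugX j (comp (n := j) (b := 0) i i.isLt rfl
      rfl (gen k s j) (mcSum c N)) = ∑ l ∈ Finset.range N, G j l := fun j => by
    rw [hG, Finset.sum_comm, Finset.smul_sum, Finset.sum_range]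
    refine Finset.sum_congr rfl fun i _ => ?_
    rw [mcSum, map_sum, ← plugL_apply, map_sum, Finset.smul_sum]
    refine Finset.sum_congr rfl fun l _ => ?_
    rw [map_smul, map_smul, smul_smul, plugL_apply, genComp_eq i.isLt (by omega),
      plugX_comp (n := j + l + 1) (b := l + 1)]
    rfl
  -- The d(m_n) contribute the triangle a + b < N and the inserted dx contributes the square a, b <
  -- N, with a minus sign because m is odd.
  have h₃ : der δm (mcSum c N) hδ 0 (0 + 1) (mcSum c N) =
      ∑ x ∈ Finset.range N ×ˢ Finset.range N with x.1 + x.2 < N, G x.1 x.2 -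
        ∑ x ∈ Finset.range N ×ˢ Finset.range N, G x.1 x.2 := by
    rw [← sum_range_antidiagonal, Finset.sum_product, ← Finset.sum_sub_distrib]
    conv_lhs => arg 2; rw [mcSum]
    rw [map_sum]
    refine Finset.sum_congr rfl fun j _ => ?_
    rw [map_smul, ← h₁, ← h₂, ← smul_sub]
    refine congrArg _ ((der_plugX δm (mcSum c N) hδ _).trans ?_)
    rw [sub_eq_add_neg]
    refine congrArg₂ _ ?_ ?_
    · simp [derMono]
    · change sgn k 1 • _ = _
      rw [sgn_one, neg_one_smul]
      rfl
  rw [h₃, ← Finset.sum_filter_add_sum_filter_not (Finset.range N ×ˢ Finset.range N)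
    (fun x => x.1 + x.2 < N), sub_add_cancel_left]
  -- The surviving terms have a + b ≥ N, and a + b + 1 copies of x are inserted.
  refine neg_mem (Submodule.sum_mem _ fun x hx => Submodule.sum_mem _ fun i _ =>
    Submodule.smul_mem _ _ (xIdeal_anti ?_ _ _ (plugX_mem (N := 0) _ _ (mem_xIdeal_zero _))))
  have := (Finset.mem_filter.mp hx).2
  omega

theorem unitCoeff_genComp (n a b i : ℕ) : unitCoeff (genComp k s n a b i) = 0 := by
  unfold genComp
  split_ifs <;> simp

theorem strip_genComp (n a b i : ℕ) (r : ZMod 2) (hr : r = 1 + 1 + 1) :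
    strip (n + 1) (1 + 1) r hr (genComp k s n a b i) =
      if a = 0 ∧ b = n ∧ i = 0 then recast (n + 1) r (gen k s n) else 0 := by
  unfold genComp
  split_ifs with h h' h'
  · obtain ⟨rfl, rfl, rfl⟩ := h'
    rw [strip_comp]
    simp [gen, stripMono, unitCoeff, unitMono]
  · rw [strip_comp]
    have : a ≠ 0 := by omega
    simp [gen, stripMono, unitCoeff, unitMono, this]
  · omega
  · simp

/-! ### The A_∞ case -/

theorem comp_generator_congr {a b b' n : ℕ} {p r : ZMod 2} {i : ℕ} (hi : i < a) (hb : b = b')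
    (hn : n + 1 = a + b) (hr : r = p + 1) (f : FreeOp k s a p) (hm : 1 ≤ b) :
    comp i hi hn hr f (of k (.m b hm)) =
      comp i hi (hb ▸ hn) hr f (of k (.m b' (hb ▸ hm))) := by
  subst hb
  rfl

theorem cobarA_succ (n : ℕ) (hn : 1 ≤ n + 1) :
    cobarA k (n + 1) hn = ∑ x ∈ Finset.HasAntidiagonal.antidiagonal n,
      ∑ i ∈ Finset.range (x.1 + 1), genComp k false n x.1 x.2 i := by
  rw [Finset.Nat.sum_antidiagonal_eq_sum_range_succ
    (fun a b => ∑ i ∈ Finset.range (a + 1), genComp k false n a b i), Finset.sum_range, cobarA]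
  refine Finset.sum_congr rfl fun a _ => ?_
  rw [Finset.sum_range]
  refine Finset.sum_congr rfl fun i _ => ?_
  rw [genComp_eq i.isLt (by omega)]
  exact comp_generator_congr _ (by omega) _ _ _ _

/-- The composite `(m (a + 1) ∘_i m (b + 1)) ∘_j m (c + 1)` if it makes sense and has arity
`n + 1`. -/
noncomputable def genCompLeft (k : Type*) [Field k] (s : Bool) (n a b c i j : ℕ) :
    FreeOp k s (n + 1) (1 + 1 + 1) :=
  if h : (i ≤ a ∧ j ≤ a + b) ∧ a + b + c = n then
    comp j (Nat.lt_succ_of_le h.1.2) (by omega) rfl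
      (comp (n := a + b + 1) i (Nat.lt_succ_of_le h.1.1) (by omega) rfl (gen k s a) (gen k s b))
      (gen k s c) else 0

theorem genCompLeft_nested {n a b c i j : ℕ} (hi : i < a + 1) (hj : j < b + 1)
    (hn : a + b + c = n) :
    genCompLeft k s n a b c i (i + j) =
      comp i hi (by omega) (add_assoc 1 1 1) (gen k s a)
        (comp (n := b + c + 1) j hj (by omega) rfl (gen k s b) (gen k s c)) := by
  rw [genCompLeft, dif_pos ⟨⟨by omega, by omega⟩, hn⟩]
  exact comp_seq hi hj _ _ _ _ _ _ _ _ _ _ _ _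

theorem genCompLeft_parallel {n a b c i j : ℕ} (hi : i < j) (hj : j ≤ a) (hn : a + b + c = n) :
    genCompLeft k s n a b c i (j + b) = -genCompLeft k s n a c b j i := by
  rw [genCompLeft, genCompLeft, dif_pos ⟨⟨by omega, by omega⟩, hn⟩,
    dif_pos ⟨⟨by omega, by omega⟩, by omega⟩,
    comp_par (j := j) (n₂ := a + c + 1) (p₂ := 1 + 1) _ (by omega) hi (by omega) _ _ (by omega)
      (by omega) _ (by omega) rfl rfl rfl rfl, mul_one, sgn_one, neg_one_smul]

theorem der_genComp (δm : ∀ n, 1 ≤ n → FreeOp k s n (1 + 1)) (δx : FreeOp k s 0 (0 + 1))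
    (hδ : ∀ hs n hn σ, perm hs σ (δm n hn) = δm n hn) {n a b i : ℕ} (hi : i < a + 1)
    (hn : n + 1 + 1 = a + 1 + (b + 1)) :
    der δm δx hδ (n + 1) (1 + 1) (genComp k s n a b i) =
      comp i hi hn rfl (δm (a + 1) (Nat.le_add_left 1 a)) (gen k s b) -
        comp i hi hn (add_assoc 1 1 1) (gen k s a) (δm (b + 1) (Nat.le_add_left 1 b)) := by
  rw [genComp_eq hi hn, der_comp, sgn_one, neg_one_smul, ← sub_eq_add_neg]
  simp [gen, derMono]

/-- The index set consists of the composites whose third vertex is attached to the root rather than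
to the second vertex. Exchanging the two upper vertices is a fixed-point-free involution that
reverses the sign, since both are odd. -/
theorem sum_genCompLeft_eq_zero (n : ℕ) :
    ∑ t ∈ {t ∈ Finset.range (n + 1) ×ˢ Finset.range (n + 1) ×ˢ Finset.range (n + 1) ×ˢ
      Finset.range (n + 1) ×ˢ Finset.range (n + 1) | ((t.2.2.2.1 ≤ t.1 ∧ t.2.2.2.2 ≤ t.1 + t.2.1) ∧
        t.1 + t.2.1 + t.2.2.1 = n) ∧ ¬ (t.2.2.2.1 ≤ t.2.2.2.2 ∧
          t.2.2.2.2 ≤ t.2.2.2.1 + t.2.1)},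
      genCompLeft k s n t.1 t.2.1 t.2.2.1 t.2.2.2.1 t.2.2.2.2 = 0 := by
  -- If the third vertex lies left of the second, then after the exchange the old second one is
  -- shifted right by c; otherwise the shift by b is undone.
  refine Finset.sum_involution (fun t _ => if t.2.2.2.2 < t.2.2.2.1 then
      (t.1, t.2.2.1, t.2.1, t.2.2.2.2, t.2.2.2.1 + t.2.2.1)
    else (t.1, t.2.2.1, t.2.1, t.2.2.2.2 - t.2.1, t.2.2.2.1)) ?_ ?_ ?_ ?_
  · rintro ⟨a, b, c, i, j⟩ ht
    simp only [Finset.mem_filter, Finset.mem_product, Finset.mem_range] at ht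
    simp only
    split_ifs with h
    · change _ + genCompLeft k s n a c b j (i + c) = 0
      rw [genCompLeft_parallel (n := n) h (by omega) (by omega), add_neg_cancel]
    · obtain ⟨j, rfl⟩ : ∃ l, j = l + b := ⟨j - b, by omega⟩
      rw [genCompLeft_parallel (by omega) (by omega) (by omega), Nat.add_sub_cancel,
        neg_add_cancel]
  · rintro ⟨a, b, c, i, j⟩ ht _
    simp only [Finset.mem_filter, Finset.mem_product, Finset.mem_range] at ht
    simp only
    split_ifs with h <;> simp only [ne_eq, Prod.mk.injEq] <;> omega
  · rintro ⟨a, b, c, i, j⟩ ht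
    simp only [Finset.mem_filter, Finset.mem_product, Finset.mem_range] at ht ⊢
    split_ifs with h <;> dsimp only <;> (refine ⟨⟨?_, ?_, ?_, ?_, ?_⟩, ⟨⟨?_, ?_⟩, ?_⟩, ?_⟩ <;> omega)
  · rintro ⟨a, b, c, i, j⟩ ht
    simp only [Finset.mem_filter, Finset.mem_product, Finset.mem_range] at ht
    simp only
    by_cases h : j < i
    · rw [if_pos h, if_neg (by simp only; omega)]
      simp
    · rw [if_neg h, if_pos (by simp only; omega)]
      simp only [Prod.mk.injEq, true_and]
      omega

theorem comp_cobarA_left {n a c j : ℕ} (hj : j < a + 1) (hn : n + 1 + 1 = a + 1 + (c + 1)) :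
    comp j hj hn rfl (cobarA k (a + 1) (Nat.le_add_left 1 a)) (gen k false c) =
      ∑ y ∈ Finset.HasAntidiagonal.antidiagonal a, ∑ i ∈ Finset.range (y.1 + 1),
        genCompLeft k false n y.1 y.2 c i j := by
  simp only [cobarA_succ, map_sum, LinearMap.sum_apply]
  refine Finset.sum_congr rfl fun y hy => Finset.sum_congr rfl fun i hi => ?_
  obtain rfl := Finset.HasAntidiagonal.mem_antidiagonal.mp hy
  have hi := Finset.mem_range.mp hi
  rw [genComp_eq hi (by omega), genCompLeft, dif_pos (by omega)]

theorem comp_cobarA_right {n a b i : ℕ} (hi : i < a + 1) (hn : n + 1 + 1 = a + 1 + (b + 1)) :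
    comp i hi hn (add_assoc 1 1 1) (gen k false a) (cobarA k (b + 1) (Nat.le_add_left 1 b)) =
      ∑ y ∈ Finset.HasAntidiagonal.antidiagonal b, ∑ j ∈ Finset.range (y.1 + 1),
        genCompLeft k false n a y.1 y.2 i (i + j) := by
  simp only [cobarA_succ, map_sum]
  refine Finset.sum_congr rfl fun y hy => Finset.sum_congr rfl fun j hj => ?_
  obtain rfl := Finset.HasAntidiagonal.mem_antidiagonal.mp hy
  have hj := Finset.mem_range.mp hj
  rw [genComp_eq hj (by omega), genCompLeft_nested hi hj (by omega)]

/-- The sum of d(m_a) ∘ m_b runs over all triple composites, that of m_a ∘ d(m_b) over exactly the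
nested ones; the difference is the parallel part, which is zero. -/
theorem der_cobarA (δx : FreeOp k false 0 (0 + 1))
    (hδ : ∀ hs n hn σ, perm hs σ (cobarA k n hn) = cobarA k n hn) (n : ℕ) (hn : 1 ≤ n) :
    der (cobarA k) δx hδ n (1 + 1) (cobarA k n hn) = 0 := by
  obtain ⟨n, rfl⟩ : ∃ m, n = m + 1 := ⟨n - 1, by omega⟩
  have h : der (cobarA k) δx hδ (n + 1) (1 + 1) (cobarA k (n + 1) hn) =
      (∑ x ∈ Finset.HasAntidiagonal.antidiagonal n, ∑ j ∈ Finset.range (x.1 + 1),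
        ∑ y ∈ Finset.HasAntidiagonal.antidiagonal x.1, ∑ i ∈ Finset.range (y.1 + 1),
          genCompLeft k false n y.1 y.2 x.2 i j) -
      ∑ x ∈ Finset.HasAntidiagonal.antidiagonal n, ∑ i ∈ Finset.range (x.1 + 1),
        ∑ y ∈ Finset.HasAntidiagonal.antidiagonal x.2, ∑ j ∈ Finset.range (y.1 + 1),
          genCompLeft k false n x.1 y.1 y.2 i (i + j) := by
    simp only [cobarA_succ n hn, map_sum, ← Finset.sum_sub_distrib]
    refine Finset.sum_congr rfl fun x hx => Finset.sum_congr rfl fun i hi => ?_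
    have hx := Finset.HasAntidiagonal.mem_antidiagonal.mp hx
    have hi := Finset.mem_range.mp hi
    rw [der_genComp _ _ _ hi (by omega), comp_cobarA_left hi (by omega),
      comp_cobarA_right hi (by omega)]
  rw [h, sub_eq_zero]
  set U : Finset (ℕ × ℕ × ℕ × ℕ × ℕ) := Finset.range (n + 1) ×ˢ Finset.range (n + 1) ×ˢ
    Finset.range (n + 1) ×ˢ Finset.range (n + 1) ×ˢ Finset.range (n + 1) with hU
  set T : Finset (ℕ × ℕ × ℕ × ℕ × ℕ) := {t ∈ U | (t.2.2.2.1 ≤ t.1 ∧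
    t.2.2.2.2 ≤ t.1 + t.2.1) ∧ t.1 + t.2.1 + t.2.2.1 = n} with hT
  trans ∑ t ∈ T, genCompLeft k false n t.1 t.2.1 t.2.2.1 t.2.2.2.1 t.2.2.2.2
  · simp only [Finset.sum_sigma']
    refine Finset.sum_nbij' (fun z => (z.2.2.1.1, z.2.2.1.2, z.1.2, z.2.2.2, z.2.1))
      (fun t => ⟨(t.1 + t.2.1, t.2.2.1), t.2.2.2.2, (t.1, t.2.1), t.2.2.2.1⟩) ?_ ?_ ?_ ?_ ?_
    · rintro ⟨⟨x1, x2⟩, j, ⟨y1, y2⟩, i⟩ hz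
      simp only [Finset.mem_sigma, Finset.HasAntidiagonal.mem_antidiagonal, Finset.mem_range] at hz
      simp only [hT, hU, Finset.mem_filter, Finset.mem_product, Finset.mem_range]
      omega
    · rintro ⟨a, b, c, i, j⟩ hz
      simp only [hT, hU, Finset.mem_filter, Finset.mem_product, Finset.mem_range] at hz
      simp only [Finset.mem_sigma, Finset.HasAntidiagonal.mem_antidiagonal, Finset.mem_range]
      refine ⟨?_, ?_, ?_, ?_⟩ <;> first | trivial | omega
    · rintro ⟨⟨x1, x2⟩, j, ⟨y1, y2⟩, i⟩ hz
      simp only [Finset.mem_sigma, Finset.HasAntidiagonal.mem_antidiagonal, Finset.mem_range] at hz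
      simp only
      rw [hz.2.2.1]
    · rintro ⟨a, b, c, i, j⟩ hz
      rfl
    · rintro ⟨⟨x1, x2⟩, j, ⟨y1, y2⟩, i⟩ hz
      rfl
  rw [← Finset.sum_filter_add_sum_filter_not T (fun t => t.2.2.2.1 ≤ t.2.2.2.2 ∧
    t.2.2.2.2 ≤ t.2.2.2.1 + t.2.1), hT, Finset.filter_filter, Finset.filter_filter,
    sum_genCompLeft_eq_zero, add_zero]
  -- It remains to identify the nested tuples, i ≤ j ≤ i + b, with the second sum through j = i +
  -- j'.
  symm
  simp only [Finset.sum_sigma']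
  refine Finset.sum_nbij' (fun z => (z.1.1, z.2.2.1.1, z.2.2.1.2, z.2.1, z.2.1 + z.2.2.2))
    (fun t => ⟨(t.1, t.2.1 + t.2.2.1), t.2.2.2.1, (t.2.1, t.2.2.1), t.2.2.2.2 - t.2.2.2.1⟩)
    ?_ ?_ ?_ ?_ ?_
  · rintro ⟨⟨x1, x2⟩, j, ⟨y1, y2⟩, i⟩ hz
    simp only [Finset.mem_sigma, Finset.HasAntidiagonal.mem_antidiagonal, Finset.mem_range] at hz
    simp only [hU, Finset.mem_filter, Finset.mem_product, Finset.mem_range]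
    omega
  · rintro ⟨a, b, c, i, j⟩ hz
    simp only [hU, Finset.mem_filter, Finset.mem_product, Finset.mem_range] at hz
    simp only [Finset.mem_sigma, Finset.HasAntidiagonal.mem_antidiagonal, Finset.mem_range]
    refine ⟨?_, ?_, ?_, ?_⟩ <;> first | trivial | omega
  · rintro ⟨⟨x1, x2⟩, j, ⟨y1, y2⟩, i⟩ hz
    simp only [Finset.mem_sigma, Finset.HasAntidiagonal.mem_antidiagonal, Finset.mem_range] at hz
    simp only [Nat.add_sub_cancel_left]
    rw [hz.2.2.1]
  · rintro ⟨a, b, c, i, j⟩ hz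
    simp only [hU, Finset.mem_filter, Finset.mem_product, Finset.mem_range] at hz
    simp only [Prod.mk.injEq, true_and]
    omega
  · rintro ⟨⟨x1, x2⟩, j, ⟨y1, y2⟩, i⟩ hz
    rfl

theorem isAcyclic_AInfMC : IsAcyclic (AInfMC.d k) := by
  refine isAcyclic_completedD _ _ ?_ ?_ _ rfl (fun n hn δx => der_cobarA δx _ n hn)
    (der_mcSum_mem _ _ _ fun n => ?_)
  · rintro (_ | n) hn
    · omega
    · simp [cobarA_succ, unitCoeff_genComp]
  · rintro (_ | n) hn r hr
    · omega
    · rw [cobarA_succ, map_sum, Finset.sum_eq_single_of_mem (0, n) (by simp [Finset.HasAntidiagonal.mem_antidiagonal])]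
      · simp [strip_genComp, gen]
      · intro x hx hne
        rw [map_sum]
        refine Finset.sum_eq_zero fun i _ => ?_
        have := Finset.HasAntidiagonal.mem_antidiagonal.mp hx
        rw [strip_genComp, if_neg]
        rintro ⟨h1, h2, -⟩
        exact hne (Prod.ext h1 h2)
  · simp only [one_mul, one_smul, cobarA_succ, ← plugL_apply, map_sum]

/-! ### The L_∞ case: shuffles and symmetrization -/

theorem perm_gen {n : ℕ} (σ : Equiv.Perm (Fin (n + 1))) :
    perm rfl σ (gen k true n) = gen k true n :=
  perm_m _ σ

-- A shuffle is determined by the image of the first l places, which can be any l-element subset.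
open Classical in
theorem card_isShuffle {n l : ℕ} (hl : l ≤ n) :
    (Finset.univ.filter fun σ : Equiv.Perm (Fin n) => IsShuffle l σ).card = n.choose l := by
  set F : Finset (Fin n) := Finset.univ.filter fun t => (t : ℕ) < l with hF
  have hFc : F.card = l := by rw [hF, Fin.card_filter_val_lt]; omega
  rw [← Finset.card_fin n, ← Finset.card_powersetCard, Finset.card_fin]
  refine Finset.card_bij (fun σ _ => F.map σ.toEmbedding) ?_ ?_ ?_
  · intro σ _
    simp [Finset.mem_powersetCard, hFc]
  · intro σ hσ σ' hσ' h
    refine shuffle_unique (Finset.mem_filter.mp hσ).2 (Finset.mem_filter.mp hσ').2 fun t ht => ?_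
    have h1 : σ' t ∈ F.map σ'.toEmbedding := by simp [hF, ht]
    rw [← h] at h1
    obtain ⟨u, hu, hut⟩ := Finset.mem_map.mp h1
    have : (σ⁻¹ * σ') t = u := by
      rw [Equiv.Perm.mul_apply, ← hut]
      simp
    rw [this]
    exact (Finset.mem_filter.mp hu).2
  · intro S hS
    have hS' := (Finset.mem_powersetCard.mp hS).2
    let e : {x // x ∈ F} ≃ {x // x ∈ S} := Fintype.equivOfCardEq (by simp [hFc, hS'])
    obtain ⟨σ, hσ, hb⟩ := shuffle_exists hl e.extendSubtype
    refine ⟨σ, by simpa using hσ, (Finset.eq_of_subset_of_card_le ?_ ?_).symm⟩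
    · intro y hy
      obtain ⟨x, hx⟩ := e.surjective ⟨y, hy⟩
      have hx' : e.extendSubtype x = y := by
        rw [Equiv.extendSubtype_apply_of_mem _ _ x.2, Subtype.coe_eta, hx]
      have hxl := hb x (Finset.mem_filter.mp x.2).2
      refine Finset.mem_map.mpr ⟨(σ⁻¹ * e.extendSubtype) x, by simpa [hF] using hxl, ?_⟩
      simp [hx']
    · rw [Finset.card_map, hFc, hS']

/-- The sum over all permutations of the inputs. -/
noncomputable def symSum (k : Type*) [Field k] (n : ℕ) (p : ZMod 2) :
    FreeOp k true n p →ₗ[k] FreeOp k true n p :=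
  ∑ σ : Equiv.Perm (Fin n), perm rfl σ

theorem symSum_apply {n : ℕ} {p : ZMod 2} (f : FreeOp k true n p) :
    symSum k n p f = ∑ σ : Equiv.Perm (Fin n), perm rfl σ f := by
  simp [symSum]

theorem symSum_perm {n : ℕ} {p : ZMod 2} (σ : Equiv.Perm (Fin n)) (f : FreeOp k true n p) :
    symSum k n p (perm rfl σ f) = symSum k n p f := by
  simp only [symSum_apply, ← perm_mul_apply]
  exact Equiv.sum_comp (Equiv.mulRight σ) fun τ => perm rfl τ f

theorem symSum_of_invariant {n : ℕ} {p : ZMod 2} {f : FreeOp k true n p}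
    (hf : ∀ σ, perm rfl σ f = f) : symSum k n p f = (n.factorial : k) • f := by
  rw [symSum_apply, Finset.sum_congr rfl fun σ _ => hf σ]
  simp [Fintype.card_perm, Nat.cast_smul_eq_nsmul]

theorem plugX_symSum {n : ℕ} {p : ZMod 2} (f : FreeOp k true n p) :
    plugX n (symSum k n p f) = (n.factorial : k) • plugX n f := by
  rw [symSum_apply, ← plugL_apply, map_sum,
    Finset.sum_congr rfl fun σ _ => 
      show plugL n p (perm rfl σ f) = plugL n p f from plugX_perm rfl σ f]
  simp [Fintype.card_perm, Nat.cast_smul_eq_nsmul, plugL_apply]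

theorem der_symSum (δm : ∀ n, 1 ≤ n → FreeOp k true n (1 + 1)) (δx : FreeOp k true 0 (0 + 1))
    (hδ : ∀ hs n hn σ, perm hs σ (δm n hn) = δm n hn) {n : ℕ} {p : ZMod 2}
    (f : FreeOp k true n p) :
    der δm δx hδ n p (symSum k n p f) = symSum k n (p + 1) (der δm δx hδ n p f) := by
  simp [symSum_apply, der_perm]

/-- By equivariance, permutations of the factors become one block permutation of the composite,
which the sum over the whole group absorbs. -/
theorem symSum_comp_perm {a b n : ℕ} {p q r : ZMod 2} {i j : ℕ} (hi : i < a) (hj : j < a)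
    (hn : n + 1 = a + b) (hr : r = p + q) (σ : Equiv.Perm (Fin a)) (hσ : σ ⟨j, hj⟩ = ⟨i, hi⟩)
    (τ : Equiv.Perm (Fin b)) (f : FreeOp k true a p) (g : FreeOp k true b q) :
    symSum k n r (comp i hi hn hr (perm rfl σ f) (perm rfl τ g)) =
      symSum k n r (comp j hj hn hr f g) := by
  have h := comp_perm rfl j hj hn hr σ τ f g
  simp only [hσ] at h
  rw [h, symSum_perm]

theorem symSum_comp_symSum_right {a b n : ℕ} {p q r : ZMod 2} {i : ℕ} (hi : i < a)
    (hn : n + 1 = a + b) (hr : r = p + q) (f : FreeOp k true a p) (g : FreeOp k true b q) :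
    symSum k n r (comp i hi hn hr f (symSum k b q g)) =
      (b.factorial : k) • symSum k n r (comp i hi hn hr f g) := by
  have h : ∀ τ, symSum k n r (comp i hi hn hr f (perm rfl τ g)) =
      symSum k n r (comp i hi hn hr f g) := fun τ => by
    have := symSum_comp_perm hi hi hn hr 1 rfl τ f g
    rwa [perm_one_apply] at this
  rw [symSum_apply g, map_sum, map_sum, Finset.sum_congr rfl fun τ _ => h τ]
  simp [Fintype.card_perm, Nat.cast_smul_eq_nsmul]

theorem sum_perm_apply_inv_zero {M : Type*} [AddCommGroup M] [Module k M] (a : ℕ)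
    (φ : Fin (a + 1) → M) : ∑ σ : Equiv.Perm (Fin (a + 1)), φ (σ⁻¹ 0) =
      (a.factorial : k) • ∑ i, φ i := by
  refine (Equiv.sum_comp (Equiv.inv (Equiv.Perm (Fin (a + 1)))) fun σ => φ (σ 0)).trans ?_
  -- A permutation amounts to its value at 0 together with one of a! permutations of the rest.
  rw [← Equiv.sum_comp Equiv.Perm.decomposeFin.symm, Fintype.sum_prod_type, Finset.smul_sum]
  simp [Fintype.card_perm, Nat.cast_smul_eq_nsmul]

/-- After symmetrization (σf) ∘_0 g becomes f ∘_i g with σ(i) = 0, and each i arises from a!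
permutations. -/
theorem symSum_comp_symSum_left {a b n : ℕ} {p q r : ZMod 2}
    (hn : n + 1 = (a + 1) + b) (hr : r = p + q) (f : FreeOp k true (a + 1) p)
    (g : FreeOp k true b q) :
    symSum k n r (comp 0 (Nat.succ_pos a) hn hr (symSum k (a + 1) p f) g) =
      (a.factorial : k) • ∑ i : Fin (a + 1), symSum k n r (comp i i.isLt hn hr f g) := by
  rw [← sum_perm_apply_inv_zero a fun i => symSum k n r (comp i i.isLt hn hr f g),
    symSum_apply f, map_sum, LinearMap.sum_apply, map_sum]
  refine Finset.sum_congr rfl fun σ _ => ?_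
  have := symSum_comp_perm (Nat.succ_pos a) (σ⁻¹ 0).isLt hn hr σ (by simp) 1 f g
  rwa [perm_one_apply] at this

theorem comp_gen_eq_perm {a b n : ℕ} {q r : ZMod 2} {i : ℕ} (hi : i < a + 1)
    (hn : n + 1 = a + 1 + b) (hr : r = 1 + q) (g : FreeOp k true b q) :
    comp i hi hn hr (gen k true a) g =
      perm rfl (blockPerm 0 (Nat.succ_pos a) hn (Equiv.swap 0 ⟨i, hi⟩) 1)
        (comp 0 (Nat.succ_pos a) hn hr (gen k true a) g) := by
  have h := comp_perm rfl 0 (Nat.succ_pos a) hn hr (Equiv.swap 0 ⟨i, hi⟩) 1 (gen k true a) g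
  rw [perm_one_apply, perm_gen] at h
  have hs : Equiv.swap 0 ⟨i, hi⟩ (⟨0, Nat.succ_pos a⟩ : Fin (a + 1)) = ⟨i, hi⟩ :=
    Equiv.swap_apply_left _ _
  simp only [hs] at h
  exact h

theorem genComp_eq_perm {n a b i : ℕ} (hi : i ≤ a) :
    ∃ σ, genComp k true n a b i = perm rfl σ (genComp k true n a b 0) := by
  by_cases hn : a + b = n
  · rw [genComp_eq (i := i) (by omega) (by omega), genComp_eq (i := 0) (by omega) (by omega),
      comp_gen_eq_perm]
    exact ⟨_, rfl⟩
  · exact ⟨1, by simp [genComp, hn]⟩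

open Classical in
theorem cobarL_succ (n : ℕ) (hn : 1 ≤ n + 1) :
    cobarL k (n + 1) hn = ∑ x ∈ Finset.HasAntidiagonal.antidiagonal n,
      ∑ σ : Equiv.Perm (Fin (n + 1)) with IsShuffle (x.2 + 1) σ,
        perm rfl σ (genComp k true n x.1 x.2 0) := by
  rw [Finset.Nat.sum_antidiagonal_eq_sum_range_succ
    (fun a b => ∑ σ : Equiv.Perm (Fin (n + 1)) with IsShuffle (b + 1) σ,
        perm rfl σ (genComp k true n a b 0)), Finset.sum_range, cobarL]
  refine Finset.sum_congr rfl fun a _ => ?_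
  have ha : n + 1 - a = n - a + 1 := by omega
  refine Finset.sum_congr (by ext; rw [ha]) fun σ _ => congrArg _ ?_
  rw [genComp_eq (Nat.succ_pos _) (by omega)]
  exact comp_generator_congr _ ha _ _ _ _

theorem factorial_smul_cobarL (n : ℕ) (hn : 1 ≤ n + 1) :
    ((n + 1).factorial : k) • cobarL k (n + 1) hn =
      ∑ x ∈ Finset.HasAntidiagonal.antidiagonal n, ((n + 1).choose (x.2 + 1) : k) •
        symSum k (n + 1) (1 + 1) (genComp k true n x.1 x.2 0) := by
  classical
  rw [← symSum_of_invariant (perm_cobarL _ _), cobarL_succ, map_sum]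
  refine Finset.sum_congr rfl fun x hx => ?_
  have hx := Finset.HasAntidiagonal.mem_antidiagonal.mp hx
  rw [map_sum, Finset.sum_congr rfl fun σ _ => symSum_perm σ _, Finset.sum_const,
    card_isShuffle (by omega), Nat.cast_smul_eq_nsmul]

/-- The element d(m_{n+1}) is invariant, hence its own average over S_{n+1}. In the average all
shuffles of one term agree, and their number divided by (n + 1)! is 1 / (a! (b + 1)!). This replaces
shuffles by full symmetrizations. -/
theorem cobarL_eq_symSum [CharZero k] (n : ℕ) (hn : 1 ≤ n + 1) :
    cobarL k (n + 1) hn =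
      ∑ x ∈ Finset.HasAntidiagonal.antidiagonal n, ((x.1.factorial : k) * (x.2 + 1).factorial)⁻¹ •
        symSum k (n + 1) (1 + 1) (genComp k true n x.1 x.2 0) := by
  have h0 : ∀ m : ℕ, (m.factorial : k) ≠ 0 := fun m => Nat.cast_ne_zero.mpr m.factorial_ne_zero
  rw [← inv_smul_smul₀ (h0 (n + 1)) (cobarL k (n + 1) hn), factorial_smul_cobarL, Finset.smul_sum]
  refine Finset.sum_congr rfl fun x hx => ?_
  obtain rfl := Finset.HasAntidiagonal.mem_antidiagonal.mp hx
  rw [smul_smul]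
  congr 1
  have := Nat.add_choose_mul_factorial_mul_factorial x.1 (x.2 + 1)
  rw [← add_assoc] at this
  have h1 := h0 (x.1 + x.2 + 1)
  have h2 := h0 x.1
  have h3 := h0 (x.2 + 1)
  rw [inv_mul_eq_iff_eq_mul₀ h1, eq_mul_inv_iff_mul_eq₀ (mul_ne_zero h2 h3), ← mul_assoc]
  exact_mod_cast this

/-! ### Symmetrized triple composites -/

theorem symSum_genCompLeft_nested {n a b c j : ℕ} (hj : j ≤ b) (hn : a + b + c = n) :
    symSum k (n + 1) (1 + 1 + 1) (genCompLeft k true n a b c 0 j) =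
      symSum k (n + 1) (1 + 1 + 1) (genCompLeft k true n a b c 0 0) := by
  have h₁ := genCompLeft_nested (k := k) (s := true) (i := 0) (j := j) (Nat.succ_pos a)
    (by omega) hn
  have h₂ := genCompLeft_nested (k := k) (s := true) (i := 0) (j := 0) (Nat.succ_pos a)
    (Nat.succ_pos b) hn
  rw [zero_add] at h₁ h₂
  obtain ⟨β, hβ⟩ := genComp_eq_perm (k := k) (n := b + c) (a := b) (b := c) hj
  rw [genComp_eq (by omega) (by omega), genComp_eq (Nat.succ_pos b) (by omega)] at hβ
  have := symSum_comp_perm (n := n + 1) (a := a + 1) (Nat.succ_pos a) (Nat.succ_pos a) (by omega)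
    (add_assoc 1 1 1) 1 rfl β (gen k true a)
    (comp (n := b + c + 1) 0 (Nat.succ_pos b) (by omega) rfl (gen k true b) (gen k true c))
  rw [perm_one_apply, ← hβ] at this
  rw [h₁, h₂]
  exact this

/-- In f ∘_0 g, with g of arity b + 1, place b + 1 is input 1 of f. The formula tracks where a
permutation of the root sends it. -/
theorem blockPerm_succ {a b n u v : ℕ} (hn : n + 1 = a + 1 + (b + 1))
    {σ : Equiv.Perm (Fin (a + 1))} {h0 : 0 < a + 1} {h1 : 1 < a + 1} {hu : u < a + 1}
    {hv : v < a + 1} (hσ0 : σ ⟨0, h0⟩ = ⟨u, hu⟩) (hσ1 : σ ⟨1, h1⟩ = ⟨v, hv⟩) {hb : b + 1 < n} :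
    (blockPerm 0 h0 hn σ 1 ⟨b + 1, hb⟩ : ℕ) = if v < u then v else v + b := by
  change blockFun 0 h0 hn σ 1 ⟨b + 1, hb⟩ = _
  unfold blockFun
  have key : (⟨b + 1 + 1 - (b + 1), by omega⟩ : Fin (a + 1)) = ⟨1, h1⟩ := Fin.ext (by simp)
  rw [dif_neg (by simp), dif_neg (by simp)]
  simp only [key, hσ0, hσ1]
  rfl

/-- A transposition of root inputs 1 and j + 1 fixes the root generator and moves the third vertex
between the two places. -/
theorem symSum_genCompLeft_parallel {n a b c j : ℕ} (hj : j < a) (hn : a + b + c = n) :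
    symSum k (n + 1) (1 + 1 + 1) (genCompLeft k true n a b c 0 (b + 1 + j)) =
      symSum k (n + 1) (1 + 1 + 1) (genCompLeft k true n a b c 0 (b + 1)) := by
  rw [genCompLeft, genCompLeft, dif_pos (by omega), dif_pos (by omega)]
  set σ : Equiv.Perm (Fin (a + 1)) := Equiv.swap ⟨1, by omega⟩ ⟨j + 1, by omega⟩ with hσ
  have hσ0 : σ ⟨0, by omega⟩ = ⟨0, by omega⟩ :=
    Equiv.swap_apply_of_ne_of_ne (by simp) (by simp)
  have h := comp_perm (n := a + b + 1) rfl 0 (Nat.succ_pos a) (by omega) rfl σ 1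
    (gen k true a) (gen k true b)
  rw [perm_one_apply, perm_gen] at h
  simp only [hσ0] at h
  have := symSum_comp_perm (n := n + 1) (a := a + b + 1) (b := c + 1) (i := b + 1 + j) (j := b + 1) (by omega) (by omega)
    (by omega) rfl (blockPerm (n := a + b + 1) (a := a + 1) (b := b + 1) 0 (Nat.succ_pos a) (by omega) σ 1) (by
      have hσ1 : σ ⟨1, by omega⟩ = ⟨j + 1, by omega⟩ := Equiv.swap_apply_left _ _
      ext
      rw [blockPerm_succ _ hσ0 hσ1, if_neg (by omega)]
      simp only
      omega) 1
    (comp (n := a + b + 1) 0 (Nat.succ_pos a) (by omega) rfl (gen k true a) (gen k true b))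
    (gen k true c)
  rw [← h, perm_one_apply] at this
  exact this

/-- Parallel associativity exchanges the two odd upper vertices at the cost of a sign; transposing
root inputs 0 and 1 then restores the standard position. -/
theorem symSum_genCompLeft_swap {n a b c : ℕ} (ha : 1 ≤ a) (hn : a + b + c = n) :
    symSum k (n + 1) (1 + 1 + 1) (genCompLeft k true n a b c 0 (b + 1)) =
      -symSum k (n + 1) (1 + 1 + 1) (genCompLeft k true n a c b 0 (c + 1)) := by
  rw [add_comm b 1, genCompLeft_parallel one_pos ha hn, map_neg]
  congr 1
  rw [genCompLeft, genCompLeft, dif_pos (by omega), dif_pos (by omega)]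
  set σ : Equiv.Perm (Fin (a + 1)) := Equiv.swap ⟨0, by omega⟩ ⟨1, by omega⟩ with hσ
  have hσ0 : σ ⟨0, by omega⟩ = ⟨1, by omega⟩ := Equiv.swap_apply_left _ _
  have hσ1 : σ ⟨1, by omega⟩ = ⟨0, by omega⟩ := Equiv.swap_apply_right _ _
  have h := comp_perm (n := a + c + 1) rfl 0 (Nat.succ_pos a) (by omega) rfl σ 1
    (gen k true a) (gen k true c)
  rw [perm_one_apply, perm_gen] at h
  simp only [hσ0] at h
  have := symSum_comp_perm (n := n + 1) (a := a + c + 1) (b := b + 1) (i := 0) (j := c + 1) (by omega) (by omega)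
    (by omega) rfl (blockPerm (n := a + c + 1) (a := a + 1) (b := c + 1) 0 (Nat.succ_pos a) (by omega) σ 1) (by
      ext
      rw [blockPerm_succ _ hσ0 hσ1, if_pos (by omega)]) 1
    (comp (n := a + c + 1) 0 (Nat.succ_pos a) (by omega) rfl (gen k true a) (gen k true c))
    (gen k true b)
  rw [← h, perm_one_apply] at this
  exact this

/-! ### The L_∞ case: the differential -/

theorem strip_cobarL (n : ℕ) (hn : 1 ≤ n) (r : ZMod 2) (hr : r = 1 + 1 + 1) :
    strip n (1 + 1) r hr (cobarL k n hn) = recast n r (of k (.m n hn)) := by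
  classical
  obtain ⟨n, rfl⟩ : ∃ m, n = m + 1 := ⟨n - 1, by omega⟩
  rw [cobarL_succ, map_sum, Finset.sum_eq_single_of_mem (0, n)
    (by simp [Finset.HasAntidiagonal.mem_antidiagonal])]
  -- For root m_1 all n + 1 inputs lie in the first block, so there is exactly one shuffle.
  · rw [map_sum, Finset.sum_congr rfl fun σ _ =>
      show strip (n + 1) (1 + 1) r hr (perm rfl σ (genComp k true n 0 n 0)) =
          recast (n + 1) r (gen k true n) by
        rw [strip_perm, strip_genComp, if_pos ⟨rfl, rfl, rfl⟩, recast_perm (by rw [hr]; rfl),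
          perm_gen], Finset.sum_const, card_isShuffle le_rfl, Nat.choose_self, one_smul]
    rfl
  · intro x hx hne
    rw [map_sum]
    refine Finset.sum_eq_zero fun σ _ => ?_
    rw [strip_perm, strip_genComp, if_neg, map_zero]
    rintro ⟨h1, h2, -⟩
    exact hne (Prod.ext h1 h2)

theorem unitCoeff_cobarL (n : ℕ) (hn : 1 ≤ n) : unitCoeff (cobarL k n hn) = 0 := by
  classical
  obtain ⟨n, rfl⟩ : ∃ m, n = m + 1 := ⟨n - 1, by omega⟩
  simp [cobarL_succ, unitCoeff_genComp]

theorem cast_factorial_ne_zero [CharZero k] (m : ℕ) : (m.factorial : k) ≠ 0 :=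
  Nat.cast_ne_zero.mpr m.factorial_ne_zero

/-- Once all inputs are x, neither permutations nor the position i matter. The a + 1 equal terms
turn 1 / (a + 1)! into 1 / a!, the coefficient from `cobarL_eq_symSum`. -/
theorem plugX_cobarL [CharZero k] (n : ℕ) :
    ((n + 1).factorial : k)⁻¹ • plugX (n + 1) (cobarL k (n + 1) (Nat.le_add_left 1 n)) =
      ∑ x ∈ Finset.HasAntidiagonal.antidiagonal n, ∑ i ∈ Finset.range (x.1 + 1),
        (((x.1 + 1).factorial : k)⁻¹ * ((x.2 + 1).factorial : k)⁻¹) •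
          plugX (n + 1) (genComp k true n x.1 x.2 i) := by
  rw [cobarL_eq_symSum, ← plugL_apply, map_sum, Finset.smul_sum]
  refine Finset.sum_congr rfl fun x _ => ?_
  have h : ∀ i ∈ Finset.range (x.1 + 1), plugX (n + 1) (genComp k true n x.1 x.2 i) =
      plugX (n + 1) (genComp k true n x.1 x.2 0) := fun i hi => by
    obtain ⟨σ, hσ⟩ := genComp_eq_perm (k := k) (n := n) (b := x.2)
      (Nat.lt_succ_iff.mp (Finset.mem_range.mp hi))
    rw [hσ, plugX_perm]
  rw [Finset.sum_congr rfl fun i hi => congrArg _ (h i hi), Finset.sum_const, Finset.card_range,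
    map_smul, plugL_apply, plugX_symSum, ← Nat.cast_smul_eq_nsmul k, smul_smul, smul_smul,
    smul_smul, Nat.factorial_succ x.1]
  congr 1
  have h1 := cast_factorial_ne_zero (k := k) (n + 1)
  have h2 := cast_factorial_ne_zero (k := k) x.1
  have h3 := cast_factorial_ne_zero (k := k) (x.2 + 1)
  have h4 : ((x.1 + 1 : ℕ) : k) ≠ 0 := Nat.cast_ne_zero.mpr (Nat.succ_ne_zero _)
  rw [Nat.cast_mul]
  field_simp

/-- Of the inputs of m_{y.1+1} ∘_0 m_{y.2+1}, the first y.2 + 1 belong to the upper vertex and give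
nested composites; the other y.1 belong to the root and give parallel ones. -/
theorem symSum_comp_cobarL_left [CharZero k] {n a c : ℕ} (hn : a + c = n) :
    symSum k (n + 1) (1 + 1 + 1) (comp 0 (Nat.succ_pos a) (by omega) rfl
      (cobarL k (a + 1) (Nat.le_add_left 1 a)) (gen k true c)) =
    ∑ y ∈ Finset.HasAntidiagonal.antidiagonal a,
      ((y.1.factorial : k) * (y.2 + 1).factorial)⁻¹ • (a.factorial : k) •
        (((y.2 + 1 : ℕ) : k) • symSum k (n + 1) (1 + 1 + 1)
            (genCompLeft k true n y.1 y.2 c 0 0) +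
          (y.1 : k) • symSum k (n + 1) (1 + 1 + 1)
            (genCompLeft k true n y.1 y.2 c 0 (y.2 + 1))) := by
  rw [cobarL_eq_symSum, map_sum, LinearMap.sum_apply, map_sum]
  refine Finset.sum_congr rfl fun y hy => ?_
  obtain rfl := Finset.HasAntidiagonal.mem_antidiagonal.mp hy
  rw [map_smul, LinearMap.smul_apply, map_smul, symSum_comp_symSum_left]
  congr 2
  have h : ∀ i : Fin (y.1 + y.2 + 1), comp (n := n + 1) i i.isLt (by omega) rfl
      (genComp k true (y.1 + y.2) y.1 y.2 0) (gen k true c) =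
        genCompLeft k true n y.1 y.2 c 0 i := fun i => by
    rw [genComp_eq (Nat.succ_pos _) (by omega), genCompLeft, dif_pos (by omega)]
  simp only [h]
  rw [Fin.sum_univ_eq_sum_range (fun i => symSum k (n + 1) (1 + 1 + 1)
    (genCompLeft k true n y.1 y.2 c 0 i)), show y.1 + y.2 + 1 = y.2 + 1 + y.1 by ring,
    Finset.sum_range_add]
  congr 1
  · rw [Finset.sum_congr rfl fun i hi => symSum_genCompLeft_nested
      (Nat.lt_succ_iff.mp (Finset.mem_range.mp hi)) hn, Finset.sum_const, Finset.card_range,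
      Nat.cast_smul_eq_nsmul]
  · rw [Finset.sum_congr rfl fun i hi => symSum_genCompLeft_parallel (Finset.mem_range.mp hi) hn,
      Finset.sum_const, Finset.card_range, Nat.cast_smul_eq_nsmul]

theorem symSum_comp_cobarL_right [CharZero k] {n a b : ℕ} (hn : a + b = n) :
    symSum k (n + 1) (1 + 1 + 1) (comp 0 (Nat.succ_pos a) (by omega) (add_assoc 1 1 1)
      (gen k true a) (cobarL k (b + 1) (Nat.le_add_left 1 b))) =
    ∑ y ∈ Finset.HasAntidiagonal.antidiagonal b,
      ((y.1.factorial : k) * (y.2 + 1).factorial)⁻¹ • ((b + 1).factorial : k) •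
        symSum k (n + 1) (1 + 1 + 1) (genCompLeft k true n a y.1 y.2 0 0) := by
  rw [cobarL_eq_symSum, map_sum, map_sum]
  refine Finset.sum_congr rfl fun y hy => ?_
  obtain rfl := Finset.HasAntidiagonal.mem_antidiagonal.mp hy
  rw [map_smul, map_smul, symSum_comp_symSum_right]
  congr 3
  rw [genComp_eq (Nat.succ_pos _) (by omega)]
  exact (genCompLeft_nested (i := 0) (j := 0) (Nat.succ_pos a) (Nat.succ_pos _) (by omega)).symm

theorem sum_antidiagonal_assoc {M : Type*} [AddCommMonoid M] (n : ℕ) (F : ℕ → ℕ → ℕ → M) :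
    ∑ x ∈ Finset.HasAntidiagonal.antidiagonal n, ∑ y ∈ Finset.HasAntidiagonal.antidiagonal x.1,
      F y.1 y.2 x.2 =
    ∑ x ∈ Finset.HasAntidiagonal.antidiagonal n, ∑ y ∈ Finset.HasAntidiagonal.antidiagonal x.2,
      F x.1 y.1 y.2 := by
  simp only [Finset.sum_sigma']
  refine Finset.sum_nbij' (fun z => ⟨(z.2.1, z.2.2 + z.1.2), (z.2.2, z.1.2)⟩)
    (fun z => ⟨(z.1.1 + z.2.1, z.2.2), (z.1.1, z.2.1)⟩) ?_ ?_ ?_ ?_ ?_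
  all_goals
    rintro ⟨⟨x1, x2⟩, ⟨y1, y2⟩⟩ hz
    simp only [Finset.mem_sigma, Finset.HasAntidiagonal.mem_antidiagonal] at hz
    obtain ⟨rfl, rfl⟩ := hz
    simp [Finset.HasAntidiagonal.mem_antidiagonal, add_assoc]

/-- For a fixed root the coefficients are symmetric in the two upper vertices and the composites
antisymmetric, so the sum is its own negative. -/
theorem sum_parallel_eq_zero [CharZero k] (n : ℕ) :
    ∑ x ∈ Finset.HasAntidiagonal.antidiagonal n, ∑ y ∈ Finset.HasAntidiagonal.antidiagonal x.2,
      (((x.1.factorial : k) * (y.1 + 1).factorial * (y.2 + 1).factorial)⁻¹ * x.1) •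
        symSum k (n + 1) (1 + 1 + 1) (genCompLeft k true n x.1 y.1 y.2 0 (y.1 + 1)) = 0 := by
  refine Finset.sum_eq_zero fun x hx => ?_
  have hx := Finset.HasAntidiagonal.mem_antidiagonal.mp hx
  set S := ∑ y ∈ Finset.HasAntidiagonal.antidiagonal x.2,
      (((x.1.factorial : k) * (y.1 + 1).factorial * (y.2 + 1).factorial)⁻¹ * x.1) •
        symSum k (n + 1) (1 + 1 + 1) (genCompLeft k true n x.1 y.1 y.2 0 (y.1 + 1)) with hS
  have h : S = -S := by
    conv_lhs => rw [hS, ← Finset.Nat.sum_antidiagonal_swap]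
    rw [hS, ← Finset.sum_neg_distrib]
    refine Finset.sum_congr rfl fun y hy => ?_
    have hy := Finset.HasAntidiagonal.mem_antidiagonal.mp hy
    -- A root with a single input carries no parallel pair; the factor `x.1` removes this case.
    rcases Nat.eq_zero_or_pos x.1 with h0 | h0
    · simp [h0]
    · simp only [Prod.fst_swap, Prod.snd_swap]
      rw [symSum_genCompLeft_swap h0 (by omega), smul_neg, mul_right_comm (x.1.factorial : k)]
  have h2 : (2 : k) • S = 0 := by
    rw [two_smul]
    nth_rewrite 1 [h]
    exact neg_add_cancel S
  exact (smul_eq_zero.mp h2).resolve_left two_ne_zero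

theorem der_cobarL [CharZero k] (δx : FreeOp k true 0 (0 + 1))
    (hδ : ∀ hs n hn σ, perm hs σ (cobarL k n hn) = cobarL k n hn) (n : ℕ) (hn : 1 ≤ n) :
    der (cobarL k) δx hδ n (1 + 1) (cobarL k n hn) = 0 := by
  obtain ⟨n, rfl⟩ : ∃ m, n = m + 1 := ⟨n - 1, by omega⟩
  have h0 := cast_factorial_ne_zero (k := k)
  -- N and P are the nested and parallel contributions. From d(m) ∘ m the nested coefficient is (b +
  -- 1) / (a! (b + 1)! (c + 1)!), from m ∘ d(m) it is 1 / (a! b! (c + 1)!): they agree, so only P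
  -- survives.
  set N : ℕ → ℕ → ℕ → FreeOp k true (n + 1) (1 + 1 + 1) := fun a b c =>
    ((a.factorial : k) * b.factorial * (c + 1).factorial)⁻¹ •
      symSum k (n + 1) (1 + 1 + 1) (genCompLeft k true n a b c 0 0) with hN
  set P : ℕ → ℕ → ℕ → FreeOp k true (n + 1) (1 + 1 + 1) := fun a b c =>
    (((a.factorial : k) * (b + 1).factorial * (c + 1).factorial)⁻¹ * a) •
      symSum k (n + 1) (1 + 1 + 1) (genCompLeft k true n a b c 0 (b + 1)) with hP
  have key : der (cobarL k) δx hδ (n + 1) (1 + 1) (cobarL k (n + 1) hn) =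
      ∑ x ∈ Finset.HasAntidiagonal.antidiagonal n,
        (∑ y ∈ Finset.HasAntidiagonal.antidiagonal x.1, (N y.1 y.2 x.2 + P y.1 y.2 x.2) -
          ∑ y ∈ Finset.HasAntidiagonal.antidiagonal x.2, N x.1 y.1 y.2) := by
    conv_lhs => arg 2; rw [cobarL_eq_symSum]
    rw [map_sum]
    refine Finset.sum_congr rfl fun x hx => ?_
    have hx := Finset.HasAntidiagonal.mem_antidiagonal.mp hx
    rw [map_smul, der_symSum, der_genComp _ _ _ (Nat.succ_pos _) (by omega), map_sub,
      symSum_comp_cobarL_left hx, symSum_comp_cobarL_right hx, smul_sub, Finset.smul_sum,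
      Finset.smul_sum]
    have h1 := h0 x.1
    have h2 := h0 (x.2 + 1)
    congr 1 <;> refine Finset.sum_congr rfl fun y _ => ?_
    · have h3 := h0 y.1
      have h4 := h0 y.2
      have h5 := h0 (y.2 + 1)
      have h6 : ((y.2 + 1 : ℕ) : k) ≠ 0 := Nat.cast_ne_zero.mpr (Nat.succ_ne_zero _)
      simp only [hN, hP, smul_add, smul_smul]
      congr 2
      · rw [Nat.factorial_succ y.2, Nat.cast_mul]
        field_simp
      · field_simp
    · have h3 := h0 y.1
      have h5 := h0 (y.2 + 1)
      simp only [hN, smul_smul]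
      congr 1
      field_simp
  rw [key, Finset.sum_sub_distrib]
  simp only [Finset.sum_add_distrib]
  rw [sum_antidiagonal_assoc n N, sum_antidiagonal_assoc n P, add_sub_cancel_left]
  exact sum_parallel_eq_zero n

theorem isAcyclic_LInfMC [CharZero k] : IsAcyclic (LInfMC.d k) :=
  isAcyclic_completedD _ _ unitCoeff_cobarL strip_cobarL _ (by simp)
    (fun n hn δx => der_cobarL δx _ n hn) (der_mcSum_mem _ _ _ plugX_cobarL)

end MCOperad

theorem corollary6p8 {k : Type*} [Field k] [CharZero k] :
    MCOperad.IsAcyclic (MCOperad.LInfMC.d k) ∧ MCOperad.IsAcyclic (MCOperad.AInfMC.d k) :=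
  ⟨MCOperad.isAcyclic_LInfMC, MCOperad.isAcyclic_AInfMC⟩
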